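/- Notation. For $1<\rho<\infty$ let $$\mathbb{E}_\rho=\Big\{z\in\mathbb{C} : \frac{(\operatorname{Re} z)^2}{((\rho+\rho^{-1})/2)^2}+\frac{(\operatorname{Im} z)^2}{((\rho-\rho^{-1})/2)^2}<1\Big\},\qquad \mathbb{E}_\infty=\mathbb{C},$$ be the open Bernstein ellipse. For $F:[-1,1]\to\mathbb{R}$ let $\rho_A[F]\in[1,\infty]$ be the parameter of the largest open Bernstein ellipse to which $F$ continues analytically: $\rho_A[F]=1$ if there is no such ellipse, and $\rho_A[F]=\infty$ if $F$ continues to an entire function. The analytic continuation of $F$ to $\mathbb{E}_{\rho_A[F]}$ is again denoted by $F$. For $0<r<1$ let $\mathcal{A}_r$ be the set of continuous, strictly increasing functions $\varphi:[-1,1]\to\mathbb{R}$ with $\varphi(-1)=r$, $\varphi(1)=1$ and $\rho_A[\varphi]>1$. For $\varphi\in\mathcal{A}_r$ put $\hat\rho[\varphi]=\rho_A[\varphi]$ if $\inf_{u\in\mathbb{E}_{\rho_A[\varphi]}}\operatorname{Re}\varphi(u)\ge 0$; otherwise let $\hat\rho[\varphi]=\rho_0[\varphi]$ be the unique $\rho$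 with $1<\rho<\rho_A[\varphi]$ and $\inf_{u\in\mathbb{E}_\rho}\operatorname{Re}\varphi(u)=0$. Let $K(k)=\int_0^{\pi/2}\frac{d\theta}{\sqrt{1-k^2\sin^2\theta}}$ be the complete elliptic integral of the first kind, $\operatorname{dn}(\cdot,k)$ Jacobi's delta amplitude function with modulus $k$ (as a meromorphic function on $\mathbb{C}$), and, with $k=\sqrt{1-r^2}$ and $q=e^{-\pi K(r)/K(k)}$, $$\Phi_r(u)=\operatorname{dn}\!\left(\frac{K(k)\arccos u}{\pi},k\right),\qquad u\in\mathbb{C},$$ whose value does not depend on the chosen value of the multivalued inverse cosine. Theorem. Let $0<r<1$. Then $\Phi_r$ is real on $[-1,1]$, its restriction to $[-1,1]$ belongs to $\mathcal{A}_r$, and $\hat\rho[\Phi_r]=\max_{\varphi\in\mathcal{A}_r}\hat\rho[\varphi]$. For $\varphi\in\mathcal{A}_r$, the maximum value of $\hat\rho$ over $\mathcal{A}_r$ is attained at $\varphi$ if and only if $\varphi(u)=\Phi_r(u)$ on $\mathbb{E}_{q^{-1}}$. Moreover $$\hat\rho[\Phi_r]=\rho_A[\Phi_r]=q^{-1}=e^{\pi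 K(r)/K(\sqrt{1-r^2})}.$$ -/

import Mathlib

open Set Filter Topology

noncomputable section

namespace ExpSum

/-- The open Bernstein ellipse `𝔼_ρ` with foci `±1` and sum of semi-axes `ρ` (meant for `1 < ρ`),
with `𝔼_∞ = ℂ`. -/
def bernsteinEllipse (ρ : EReal) : Set ℂ :=
  if ρ = ⊤ then univ
  else {z : ℂ | z.re ^ 2 / ((ρ.toReal + ρ.toReal⁻¹) / 2) ^ 2
      + z.im ^ 2 / ((ρ.toReal - ρ.toReal⁻¹) / 2) ^ 2 < 1}

/-- `G` is an analytic continuation to `𝔼_ρ` of the function `F` on `[-1, 1]`. Here, and in all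
notions below, only the values of `F : ℝ → ℝ` on `[-1, 1]` matter. -/
def IsContinuation (F : ℝ → ℝ) (ρ : EReal) (G : ℂ → ℂ) : Prop :=
  AnalyticOnNhd ℂ G (bernsteinEllipse ρ) ∧ ∀ x ∈ Icc (-1 : ℝ) 1, G (x : ℂ) = (F x : ℂ)

/-- `ρ_A[F]`, the parameter of the largest open Bernstein ellipse to which `F` continues
analytically; it is `1` if there is none, and `⊤` if `F` continues to an entire function. -/
def rhoA (F : ℝ → ℝ) : EReal :=
  sSup (insert 1 {ρ : EReal | 1 < ρ ∧ ∃ G : ℂ → ℂ, IsContinuation F ρ G})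

theorem toReal_gt_one {ρ : EReal} (h1 : 1 < ρ) (ht : ρ ≠ ⊤) : 1 < ρ.toReal := by
  lift ρ to ℝ using ⟨ht, fun h => by simp [h] at h1⟩
  simpa using (by exact_mod_cast h1 : (1 : ℝ) < ρ)

theorem isOpen_bernsteinEllipse (ρ : EReal) : IsOpen (bernsteinEllipse ρ) := by
  unfold bernsteinEllipse
  split_ifs
  · exact isOpen_univ
  · exact isOpen_lt (by fun_prop) continuous_const

theorem bernsteinEllipse_mono {ρ σ : EReal} (h1 : 1 < ρ) (h : ρ ≤ σ) :
    bernsteinEllipse ρ ⊆ bernsteinEllipse σ := by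
  unfold bernsteinEllipse
  by_cases hs : σ = ⊤
  · simp [hs]
  have hr : ρ ≠ ⊤ := fun hr => hs (top_le_iff.mp (hr ▸ h))
  have a1 := toReal_gt_one h1 hr
  have a2 : ρ.toReal ≤ σ.toReal :=
    EReal.toReal_le_toReal h (fun h => by simp [h] at h1) hs
  rw [if_neg hs, if_neg hr]
  intro z hz
  simp only [mem_ofPred_eq] at hz ⊢
  set a := ρ.toReal
  set b := σ.toReal
  have b1 : b⁻¹ ≤ a⁻¹ := inv_anti₀ (by linarith) a2
  have a3 : a⁻¹ < 1 := inv_lt_one_of_one_lt₀ a1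
  have a4 : 0 < a⁻¹ := by positivity
  have hab : a * a⁻¹ = 1 := mul_inv_cancel₀ (by positivity)
  have hbb : b * b⁻¹ = 1 := mul_inv_cancel₀ (by linarith)
  have c1 : (a + a⁻¹) / 2 ≤ (b + b⁻¹) / 2 := by
    have b0 : 0 < b⁻¹ := inv_pos.mpr (by linarith)
    have key : (b - a) - (a⁻¹ - b⁻¹) = (b - a) * (1 - a⁻¹ * b⁻¹) := by
      linear_combination (a⁻¹ * hbb - b⁻¹ * hab)
    have : a⁻¹ * b⁻¹ ≤ 1 := by nlinarith
    nlinarith [mul_nonneg (sub_nonneg.mpr a2) (sub_nonneg.mpr this)]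
  refine lt_of_le_of_lt ?_ hz
  gcongr
  · nlinarith
  · linarith

theorem convex_bernsteinEllipse {ρ : EReal} (h1 : 1 < ρ) : Convex ℝ (bernsteinEllipse ρ) := by
  unfold bernsteinEllipse
  split_ifs with ht
  · exact convex_univ
  have a1 := toReal_gt_one h1 ht
  intro z hz w hw s t hs ht' hst
  simp only [mem_ofPred_eq, Complex.add_re, Complex.add_im, Complex.smul_re, Complex.smul_im,
    smul_eq_mul] at hz hw ⊢
  set A := ((ρ.toReal + ρ.toReal⁻¹) / 2) ^ 2
  set B := ((ρ.toReal - ρ.toReal⁻¹) / 2) ^ 2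
  have hA : 0 ≤ A := by positivity
  have hB : 0 ≤ B := by positivity
  have e : ∀ x y C : ℝ, 0 ≤ C → (s * x + t * y) ^ 2 / C ≤ s * (x ^ 2 / C) + t * (y ^ 2 / C) := by
    intro x y C hC
    have : (s * x + t * y) ^ 2 ≤ s * x ^ 2 + t * y ^ 2 := by
      have : t = 1 - s := by linarith
      subst this
      nlinarith [mul_nonneg (mul_nonneg hs ht') (sq_nonneg (x - y))]
    calc (s * x + t * y) ^ 2 / C ≤ (s * x ^ 2 + t * y ^ 2) / C := by gcongr
      _ = _ := by ring
  have e1 := e z.re w.re A hA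
  have e2 := e z.im w.im B hB
  set X := z.re ^ 2 / A + z.im ^ 2 / B
  set Y := w.re ^ 2 / A + w.im ^ 2 / B
  have : s * X + t * Y < 1 := by
    rcases hs.lt_or_eq with h | h
    · nlinarith [mul_lt_mul_of_pos_left hz h, mul_le_mul_of_nonneg_left hw.le ht']
    · have : t = 1 := by linarith
      subst this; rw [← h]; linarith
  have : s * X + t * Y = s * (z.re ^ 2 / A) + t * (w.re ^ 2 / A)
      + (s * (z.im ^ 2 / B) + t * (w.im ^ 2 / B)) := by simp only [X, Y]; ring
  linarith

theorem Icc_mem_bernsteinEllipse {ρ : EReal} (h1 : 1 < ρ) {x : ℝ} (hx : x ∈ Icc (-1 : ℝ) 1) :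
    (x : ℂ) ∈ bernsteinEllipse ρ := by
  unfold bernsteinEllipse
  split_ifs with ht
  · trivial
  have a1 := toReal_gt_one h1 ht
  simp only [mem_ofPred_eq, Complex.ofReal_re, Complex.ofReal_im]
  set a := ρ.toReal
  have hab : a * a⁻¹ = 1 := mul_inv_cancel₀ (by positivity)
  have a4 : 0 < a⁻¹ := by positivity
  have hc : 1 < (a + a⁻¹) / 2 := by
    nlinarith [mul_pos (sub_pos.mpr a1) (sub_pos.mpr (inv_lt_one_of_one_lt₀ a1))]
  have : x ^ 2 ≤ 1 := by nlinarith [hx.1, hx.2]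
  have : x ^ 2 / ((a + a⁻¹) / 2) ^ 2 < 1 := by
    rw [div_lt_one (by positivity)]; nlinarith
  simpa using this

/-- Two analytic continuations agree on the smaller ellipse. -/
theorem IsContinuation.eqOn {F : ℝ → ℝ} {ρ σ : EReal} {G H : ℂ → ℂ} (h1 : 1 < ρ) (h : ρ ≤ σ)
    (hG : IsContinuation F ρ G) (hH : IsContinuation F σ H) :
    EqOn G H (bernsteinEllipse ρ) := by
  have h0 : (0 : ℂ) ∈ bernsteinEllipse ρ := by
    simpa using Icc_mem_bernsteinEllipse h1 (x := 0) (by norm_num)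
  refine hG.1.eqOn_of_preconnected_of_frequently_eq
    (hH.1.mono (bernsteinEllipse_mono h1 h)) (convex_bernsteinEllipse h1).isPreconnected h0 ?_
  have ht : Tendsto (fun n : ℕ => (((1 / ((n : ℝ) + 1) : ℝ)) : ℂ)) atTop (𝓝[≠] 0) := by
    refine tendsto_nhdsWithin_iff.mpr ⟨?_, Eventually.of_forall fun n => ?_⟩
    · have := (Complex.continuous_ofReal.tendsto 0).comp
        (tendsto_one_div_add_atTop_nhds_zero_nat (𝕜 := ℝ))
      simpa [Function.comp_def] using this
    · simp only [mem_compl_iff, mem_singleton_iff, Complex.ofReal_eq_zero]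
      positivity
  refine ht.frequently (Frequently.of_forall fun n => ?_)
  have hx : (1 / ((n : ℝ) + 1) : ℝ) ∈ Icc (-1 : ℝ) 1 := by
    constructor
    · have : (0 : ℝ) ≤ 1 / ((n : ℝ) + 1) := by positivity
      linarith
    · rw [div_le_one (by positivity)]; linarith [n.cast_nonneg (α := ℝ)]
  rw [hG.2 _ hx, hH.2 _ hx]

/-- Every point of an ellipse lies in a strictly smaller one. -/
theorem exists_smaller {ρ : EReal} (h1 : 1 < ρ) {z : ℂ} (hz : z ∈ bernsteinEllipse ρ) :
    ∃ σ : EReal, 1 < σ ∧ σ < ρ ∧ z ∈ bernsteinEllipse σ := by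
  have key : ∀ l : Filter ℝ, l.NeBot → (∀ᶠ s : ℝ in l, 1 < s) → (∀ᶠ s : ℝ in l, (s : EReal) < ρ) →
      (∀ᶠ s : ℝ in l, z.re ^ 2 / ((s + s⁻¹) / 2) ^ 2 + z.im ^ 2 / ((s - s⁻¹) / 2) ^ 2 < 1) →
      ∃ σ : EReal, 1 < σ ∧ σ < ρ ∧ z ∈ bernsteinEllipse σ := by
    intro l _ ha hb hc
    obtain ⟨s, hs1, hs2, hs3⟩ := (ha.and (hb.and hc)).exists
    refine ⟨s, by exact_mod_cast hs1, hs2, ?_⟩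
    simpa [bernsteinEllipse] using hs3
  by_cases ht : ρ = ⊤
  · refine key atTop inferInstance (eventually_gt_atTop 1) (by simp [ht, EReal.coe_lt_top]) ?_
    have i0 : Tendsto (fun s : ℝ => s⁻¹) atTop (𝓝 0) := tendsto_inv_atTop_zero
    have p : Tendsto (fun s : ℝ => ((s + s⁻¹) / 2) ^ 2) atTop atTop :=
      (tendsto_pow_atTop two_ne_zero).comp
        ((tendsto_id.atTop_add i0).atTop_div_const two_pos)
    have m : Tendsto (fun s : ℝ => ((s - s⁻¹) / 2) ^ 2) atTop atTop := by
      refine (tendsto_pow_atTop two_ne_zero).comp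
        (Tendsto.atTop_div_const two_pos ?_)
      simpa [sub_eq_add_neg] using tendsto_id.atTop_add i0.neg
    have := (p.const_div_atTop (z.re ^ 2)).add (m.const_div_atTop (z.im ^ 2))
    exact this.eventually_lt_const (by norm_num)
  · have a1 := toReal_gt_one h1 ht
    have hcoe : ((ρ.toReal : ℝ) : EReal) = ρ :=
      EReal.coe_toReal ht (fun h => by simp [h] at h1)
    unfold bernsteinEllipse at hz
    rw [if_neg ht] at hz
    refine key (𝓝[<] ρ.toReal) inferInstance ?_ ?_ ?_
    · exact nhdsWithin_le_nhds (lt_mem_nhds a1)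
    · filter_upwards [self_mem_nhdsWithin] with s hs
      rw [← hcoe]; exact_mod_cast hs
    · refine nhdsWithin_le_nhds ?_
      have hi : ρ.toReal⁻¹ < 1 := inv_lt_one_of_one_lt₀ a1
      have hp : 0 < ρ.toReal⁻¹ := by positivity
      have c : ContinuousAt (fun s : ℝ => z.re ^ 2 / ((s + s⁻¹) / 2) ^ 2
          + z.im ^ 2 / ((s - s⁻¹) / 2) ^ 2) ρ.toReal := by
        have hne : ρ.toReal ≠ 0 := by positivity
        have h2 : ((ρ.toReal + ρ.toReal⁻¹) / 2) ^ 2 ≠ 0 := by positivity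
        have h3 : ((ρ.toReal - ρ.toReal⁻¹) / 2) ^ 2 ≠ 0 :=
          pow_ne_zero _ (by intro h; linarith)
        have ci : ContinuousAt (fun s : ℝ => s⁻¹) ρ.toReal := continuousAt_inv₀ hne
        exact (continuousAt_const.div (((continuousAt_id.add ci).div_const 2).pow 2) h2).add
          (continuousAt_const.div (((continuousAt_id.sub ci).div_const 2).pow 2) h3)
      exact c.eventually_lt_const hz

/-- `F` does continue analytically to the ellipse with parameter `ρ_A[F]`. -/
theorem exists_continuation {F : ℝ → ℝ} (h : 1 < rhoA F) :
    ∃ G : ℂ → ℂ, IsContinuation F (rhoA F) G := by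
  have step : ∀ z ∈ bernsteinEllipse (rhoA F), ∃ σ : EReal, 1 < σ ∧ z ∈ bernsteinEllipse σ ∧
      ∃ G : ℂ → ℂ, IsContinuation F σ G := by
    intro z hz
    obtain ⟨σ, hs1, hs2, hzs⟩ := exists_smaller h hz
    obtain ⟨τ, hτ, hστ⟩ := lt_sSup_iff.mp hs2
    rcases hτ with rfl | ⟨h1τ, G, hG⟩
    · exact absurd hστ (not_lt.mpr hs1.le)
    · exact ⟨τ, h1τ, bernsteinEllipse_mono hs1 hστ.le hzs, G, hG⟩
  choose! s hs1 hzs G hG using step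
  have agree : ∀ z ∈ bernsteinEllipse (rhoA F), ∀ w ∈ bernsteinEllipse (rhoA F),
      w ∈ bernsteinEllipse (s z) → G w w = G z w := by
    intro z hz w hw hwz
    rcases le_total (s z) (s w) with hle | hle
    · exact ((hG z hz).eqOn (hs1 z hz) hle (hG w hw) hwz).symm
    · exact (hG w hw).eqOn (hs1 w hw) hle (hG z hz) (hzs w hw)
  refine ⟨fun w => G w w, fun z hz => ?_, fun x hx => ?_⟩
  · refine ((hG z hz).1 z (hzs z hz)).congr ?_
    filter_upwards [(isOpen_bernsteinEllipse _).mem_nhds (hzs z hz),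
      (isOpen_bernsteinEllipse _).mem_nhds hz] with w hw hw'
    exact (agree z hz w hw' hw).symm
  · have hm := Icc_mem_bernsteinEllipse h hx
    exact (hG _ hm).2 x hx

open Classical in
/-- The analytic continuation of `F` to `𝔼_{ρ_A[F]}`; it is unique on this ellipse when
`1 < ρ_A[F]`. -/
def cont (F : ℝ → ℝ) : ℂ → ℂ :=
  if h : 1 < rhoA F then (exists_continuation h).choose else 0

theorem isContinuation_cont {F : ℝ → ℝ} (h : 1 < rhoA F) :
    IsContinuation F (rhoA F) (cont F) := by
  rw [cont, dif_pos h]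
  exact (exists_continuation h).choose_spec

/-- The infimum of `Re F` over the open Bernstein ellipse `𝔼_ρ`. -/
def infRe (F : ℝ → ℝ) (ρ : EReal) : EReal :=
  ⨅ u ∈ bernsteinEllipse ρ, ((cont F u).re : EReal)

open Classical in
/-- `ρ₀[F]`, the number `ρ` with `1 < ρ < ρ_A[F]` and `inf_{𝔼_ρ} Re F = 0`. -/
def rho0 (F : ℝ → ℝ) : ℝ :=
  if h : ∃ ρ : ℝ, 1 < ρ ∧ (ρ : EReal) < rhoA F ∧ infRe F ρ = 0 then h.choose else 1

open Classical in
/-- `ρ̂[F]`, equal to `ρ_A[F]` if `Re F` has infimum at least `0` on `𝔼_{ρ_A[F]}`, and to `ρ₀[F]`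
otherwise. -/
def rhoHat (F : ℝ → ℝ) : EReal :=
  if 0 ≤ infRe F (rhoA F) then rhoA F else (rho0 F : EReal)

/-- The variable transformations of `[-1, 1]` onto `[r, 1]` that are analytic on a neighbourhood
of `[-1, 1]`. -/
def admissible (r : ℝ) : Set (ℝ → ℝ) :=
  {φ | φ (-1) = r ∧ φ 1 = 1 ∧ ContinuousOn φ (Icc (-1) 1) ∧ StrictMonoOn φ (Icc (-1) 1) ∧
    1 < rhoA φ}

/-- The complete elliptic integral of the first kind with modulus `k`. -/
def ellipticK (k : ℝ) : ℝ :=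
  ∫ θ in (0 : ℝ)..(Real.pi / 2), 1 / √(1 - k ^ 2 * Real.sin θ ^ 2)

/-- The lattice parameter `τ = i K(k') / K(k)`, `k' = √(1 - k²)`; the nome is `exp (π i τ)`. -/
def latticeTau (k : ℝ) : ℂ :=
  Complex.I * ((ellipticK √(1 - k ^ 2) / ellipticK k : ℝ) : ℂ)

/-- Jacobi's function `dn(v, k)` on `ℂ`, defined through theta functions in the usual way:
`dn(v, k) = (θ₄(0) / θ₃(0)) * (θ₃(ζ) / θ₄(ζ))` with `ζ = π v / (2 K(k))` and the nome of `k`.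
In terms of `jacobiTheta₂ z τ = ∑ exp (2 π i n z + π i n² τ)` one has `θ₃(π z) = jacobiTheta₂ z τ`
and `θ₄(π z) = jacobiTheta₂ (z + 1 / 2) τ`. (At the poles the value is `0`.) -/
def jacobiDn (v : ℂ) (k : ℝ) : ℂ :=
  jacobiTheta₂ (1 / 2) (latticeTau k) / jacobiTheta₂ 0 (latticeTau k) *
    (jacobiTheta₂ (v / (2 * ellipticK k)) (latticeTau k) /
      jacobiTheta₂ (v / (2 * ellipticK k) + 1 / 2) (latticeTau k))

/-- A value of the multivalued inverse cosine on `ℂ`. -/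
def arccosC (u : ℂ) : ℂ := Function.surjInv Complex.cos_surjective u

/-- `Φ_r(u) = dn(K(k) arccos(u) / π, k)` with `k = √(1 - r²)`. -/
def Phi (r : ℝ) (u : ℂ) : ℂ :=
  jacobiDn (ellipticK √(1 - r ^ 2) * arccosC u / Real.pi) √(1 - r ^ 2)

/-- The restriction of `Φ_r` to the real axis. -/
def PhiReal (r : ℝ) (x : ℝ) : ℝ := (Phi r (x : ℂ)).re

theorem jacobiDn_neg (v : ℂ) (k : ℝ) : jacobiDn (-v) k = jacobiDn v k := by
  have h : jacobiTheta₂ (-(v / (2 * ellipticK k)) + 1 / 2) (latticeTau k)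
      = jacobiTheta₂ (v / (2 * ellipticK k) + 1 / 2) (latticeTau k) := by
    rw [← jacobiTheta₂_neg_left, ← jacobiTheta₂_add_left]
    congr 1; ring
  rw [jacobiDn, jacobiDn, neg_div, jacobiTheta₂_neg_left, h]

theorem jacobiDn_add_int (v : ℂ) (k : ℝ) (n : ℤ) :
    jacobiDn (v + 2 * ellipticK k * n) k = jacobiDn v k := by
  by_cases hK : (ellipticK k : ℂ) = 0
  · simp [hK]
  have per : ∀ (m : ℤ) (z τ : ℂ), jacobiTheta₂ (z + m) τ = jacobiTheta₂ z τ := by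
    intro m z τ
    simp only [jacobiTheta₂, jacobiTheta₂_term]
    refine tsum_congr fun j => ?_
    rw [← Complex.exp_periodic.int_mul (j * m) (2 * Real.pi * Complex.I * j * z + _)]
    congr 1; push_cast; ring
  have e : (v + 2 * ellipticK k * n) / (2 * ellipticK k) = v / (2 * ellipticK k) + n := by
    field_simp
  rw [jacobiDn, jacobiDn, e, per, show v / (2 * (ellipticK k : ℂ)) + n + 1 / 2
    = v / (2 * ellipticK k) + 1 / 2 + n by ring, per]

/-- `Φ_r` does not depend on the chosen value of the inverse cosine. -/
theorem Phi_cos (r : ℝ) (z : ℂ) :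
    Phi r (Complex.cos z) = jacobiDn (ellipticK √(1 - r ^ 2) * z / Real.pi) √(1 - r ^ 2) := by
  have h : Complex.cos (arccosC (Complex.cos z)) = Complex.cos z :=
    Function.surjInv_eq Complex.cos_surjective _
  have hpi : (Real.pi : ℂ) ≠ 0 := by exact_mod_cast Real.pi_ne_zero
  set K : ℂ := (ellipticK √(1 - r ^ 2) : ℂ) with hKdef
  rw [Phi, ← hKdef]
  rw [Complex.cos_eq_cos_iff] at h
  generalize arccosC (Complex.cos z) = w at h
  obtain ⟨n, rfl | rfl⟩ := h
  · rw [show K * (2 * n * Real.pi + w) / Real.pi = K * w / Real.pi + 2 * K * n by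
      field_simp; ring, hKdef, jacobiDn_add_int]
  · rw [show K * (2 * n * Real.pi - w) / Real.pi = -(K * w / Real.pi) + 2 * K * n by
      field_simp; ring, hKdef, jacobiDn_add_int, jacobiDn_neg]

end ExpSum

end

/-! Put `k = √(1 - r²)` and `s = K(r)/K(k)`, so that `q⁻¹ = exp (π s)`. Under `u = cos z` the
ellipse with this parameter corresponds to the strip `|Im z| < π s`. With `ζ = z/(2π)`, `Φ_r` is a
constant times `θ(ζ)/θ(ζ + 1/2)`, where `θ` is Jacobi's `θ₃` with lattice parameter `i s`. The point
is that this quotient is the conformal map of the ellipse to the right half-plane with values `1` at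
`1` and `r` at `-1`.

Extremality is Schwarz's lemma. If `ρ̂[φ] ≥ q⁻¹`, the continuation of `φ` has nonnegative real part
on the ellipse. Composing `φ` and `Φ_r` with the Cayley transform gives maps `p` and `B` to the
closed disc, both zero at `1` and equal at `-1`. Since `B` is conformal, `|p/B| ≤ 1`; this quotient
is `1` at the interior point `-1`, so it is constant and `φ = Φ_r` (`eqOn_of_norm_le_one_of_proper`,
`eqOn_thetaQuo`). As `Φ_r` has a pole at `cos (iπs)` on the boundary (`not_eqOn_thetaQuo`), no
larger ellipse is possible. Bound and uniqueness thus come from one argument (`eqOn_cont_of_le`).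

Two facts on theta functions are needed. Product formulas give the mapping properties: `Re (θ(z)
conj θ(z + 1/2))` factors into a function of `Re z` and one of `Im z` (`ofReal_re_theta_mul_conj`),
and the difference of two values of the quotient factors as well (`theta_cross_sub`). The value
`(θ₄(0)/θ₃(0))² = r` at `-1` (`thetaModulus_ratio`) comes from the arithmetic-geometric mean, the
modular transformation and the monotonicity of `K(r)/K(k)` in `r`. -/

noncomputable section

namespace ExpSum

section

open Complex ComplexOrder ComplexConjugate

/-! ### Theta functions with purely imaginary lattice parameter -/

/-- Jacobi's theta function `θ₃` with lattice parameter `i s` and period `1`. -/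
def theta (s : ℝ) (z : ℂ) : ℂ := jacobiTheta₂ z (I * s)

theorem theta_add_one (s : ℝ) (z : ℂ) : theta s (z + 1) = theta s z :=
  jacobiTheta₂_add_left _ _

theorem theta_sub_one (s : ℝ) (z : ℂ) : theta s (z - 1) = theta s z := by
  rw [← theta_add_one, sub_add_cancel]

theorem theta_add_int (s : ℝ) (z : ℂ) (n : ℤ) : theta s (z + n) = theta s z := by
  have h : Function.Periodic (theta s) 1 := theta_add_one s
  simpa using h.int_mul n z

theorem theta_neg (s : ℝ) (z : ℂ) : theta s (-z) = theta s z :=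
  jacobiTheta₂_neg_left _ _

theorem theta_half_sub (s : ℝ) (z : ℂ) : theta s (-z + 1 / 2) = theta s (z + 1 / 2) := by
  rw [← theta_neg, ← theta_add_one]
  ring_nf

theorem theta_add_period (s : ℝ) (z : ℂ) :
    theta s (z + I * s) = cexp (Real.pi * s - 2 * Real.pi * I * z) * theta s z := by
  rw [theta, theta, jacobiTheta₂_add_left']
  congr 2
  linear_combination (-Real.pi * s : ℂ) * I_sq

theorem conj_theta (s : ℝ) (z : ℂ) : conj (theta s z) = theta s (conj z) := by
  rw [theta, theta, jacobiTheta₂_conj]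
  simp

/-- The terms of the series of `theta`. -/
def thetaTerm (s : ℝ) (z : ℂ) (n : ℤ) : ℂ :=
  cexp (2 * Real.pi * I * n * z - Real.pi * n ^ 2 * s)

theorem thetaTerm_eq (s : ℝ) (z : ℂ) (n : ℤ) :
    thetaTerm s z n = jacobiTheta₂_term n z (I * s) := by
  rw [jacobiTheta₂_term, thetaTerm]
  congr 1
  linear_combination (-Real.pi * n ^ 2 * s : ℂ) * I_sq

theorem theta_tsum (s : ℝ) (z : ℂ) : theta s z = ∑' n : ℤ, thetaTerm s z n := by
  simp only [theta, jacobiTheta₂, thetaTerm_eq]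

theorem summable_thetaTerm {s : ℝ} (hs : 0 < s) (z : ℂ) : Summable (thetaTerm s z) := by
  rw [funext (thetaTerm_eq s z), summable_jacobiTheta₂_term_iff]
  simpa using hs

theorem hasSum_theta_mul_theta {s : ℝ} (hs : 0 < s) (z w : ℂ) :
    HasSum (fun p : ℤ × ℤ => thetaTerm s z p.1 * thetaTerm s w p.2) (theta s z * theta s w) := by
  have hz := (summable_thetaTerm hs z).norm
  have hw := (summable_thetaTerm hs w).norm
  rw [theta_tsum, theta_tsum, tsum_mul_tsum_of_summable_norm hz hw]
  exact (summable_mul_of_summable_norm hz hw).hasSum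

theorem differentiable_theta {s : ℝ} (hs : 0 < s) : Differentiable ℂ (theta s) := fun z =>
  differentiableAt_jacobiTheta₂_fst z (by simpa using hs)

/-! ### Product formulas that double the lattice parameter -/

/-- The pairs of integers, split according to the parity of their sum. -/
def parityEquiv : (ℤ × ℤ) ⊕ (ℤ × ℤ) ≃ ℤ × ℤ where
  toFun := Sum.elim (fun p => (p.1 + p.2, p.1 - p.2)) (fun p => (p.1 + p.2 + 1, p.1 - p.2))
  invFun p := if (p.1 + p.2) % 2 = 0 then .inl ((p.1 + p.2) / 2, (p.1 - p.2) / 2)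
    else .inr ((p.1 + p.2 - 1) / 2, (p.1 - p.2 - 1) / 2)
  left_inv := by
    rintro (⟨a, b⟩ | ⟨a, b⟩)
    · have h : (a + b + (a - b)) % 2 = 0 := by omega
      simp only [Sum.elim_inl, h, if_true]
      congr 2 <;> omega
    · have h : ¬ (a + b + 1 + (a - b)) % 2 = 0 := by omega
      simp only [Sum.elim_inr, h, if_false]
      congr 2 <;> omega
  right_inv := by
    rintro ⟨a, b⟩
    by_cases h : (a + b) % 2 = 0
    · simp only [h, if_true, Sum.elim_inl]
      congr 1 <;> omega
    · simp only [h, if_false, Sum.elim_inr]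
      congr 1 <;> omega

/-- Since `(a + b)² + (a - b)² = 2a² + 2b²`, the Gaussian exponents decouple. This handles the index
pairs with even sum. -/
theorem thetaTerm_add_mul_sub (s : ℝ) (x y : ℂ) (a b : ℤ) :
    thetaTerm s (x + y) (a + b) * thetaTerm s (x - y) (a - b) =
      thetaTerm (2 * s) (2 * x) a * thetaTerm (2 * s) (2 * y) b := by
  simp only [thetaTerm, ← Complex.exp_add]
  congr 1
  push_cast
  ring

/-- For pairs with odd sum the quadratic form gains `2a + 2b + 1`. The linear terms become a shift
by `i s`, half a period of the doubled lattice. -/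
theorem thetaTerm_add_add_one_mul_sub (s : ℝ) (x y : ℂ) (a b : ℤ) :
    thetaTerm s (x + y) (a + b + 1) * thetaTerm s (x - y) (a - b) =
      cexp (2 * Real.pi * I * (x + y) - Real.pi * s) *
        (thetaTerm (2 * s) (2 * x + I * s) a * thetaTerm (2 * s) (2 * y + I * s) b) := by
  simp only [thetaTerm, ← Complex.exp_add]
  congr 1
  push_cast
  linear_combination (-2 * Real.pi * s * (a + b) : ℂ) * I_sq

/-- The product of two theta values in terms of theta functions with doubled lattice parameter. -/
theorem theta_mul_theta {s : ℝ} (hs : 0 < s) (x y : ℂ) :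
    theta s (x + y) * theta s (x - y) = theta (2 * s) (2 * x) * theta (2 * s) (2 * y) +
      cexp (2 * Real.pi * I * (x + y) - Real.pi * s) *
        (theta (2 * s) (2 * x + I * s) * theta (2 * s) (2 * y + I * s)) := by
  have h2 : 0 < 2 * s := by positivity
  have k1 := hasSum_theta_mul_theta h2 (2 * x) (2 * y)
  have k2 := (hasSum_theta_mul_theta h2 (2 * x + I * s) (2 * y + I * s)).mul_left
    (cexp (2 * Real.pi * I * (x + y) - Real.pi * s))
  simp only [← thetaTerm_add_mul_sub] at k1
  simp only [← thetaTerm_add_add_one_mul_sub] at k2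
  refine (parityEquiv.hasSum_iff.mpr (hasSum_theta_mul_theta hs (x + y) (x - y))).unique ?_
  exact HasSum.sum k1 k2

theorem theta_half_mul_theta_half {s : ℝ} (hs : 0 < s) (x y : ℂ) :
    theta s (x + y + 1 / 2) * theta s (x - y + 1 / 2) =
      theta (2 * s) (2 * x) * theta (2 * s) (2 * y) -
      cexp (2 * Real.pi * I * (x + y) - Real.pi * s) *
        (theta (2 * s) (2 * x + I * s) * theta (2 * s) (2 * y + I * s)) := by
  have h := theta_mul_theta hs (x + 1 / 2) y
  rw [show x + 1 / 2 + y = x + y + 1 / 2 by ring, show x + 1 / 2 - y = x - y + 1 / 2 by ring,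
    show 2 * (x + 1 / 2) = 2 * x + 1 by ring, show 2 * x + 1 + I * s = 2 * x + I * s + 1 by ring,
    theta_add_one, theta_add_one, show 2 * Real.pi * I * (x + y + 1 / 2) - Real.pi * s =
      (2 * Real.pi * I * (x + y) - Real.pi * s) + Real.pi * I by ring, Complex.exp_add,
    Complex.exp_pi_mul_I] at h
  rw [h]; ring

theorem theta_mul_theta_half {s : ℝ} (hs : 0 < s) (x y : ℂ) :
    theta s (x + y) * theta s (x - y + 1 / 2) =
      theta (2 * s) (2 * x + 1 / 2) * theta (2 * s) (2 * y + 1 / 2) +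
      cexp (2 * Real.pi * I * (x + y) - Real.pi * s) *
        (theta (2 * s) (2 * x + 1 / 2 + I * s) * theta (2 * s) (2 * y + 1 / 2 + I * s)) := by
  -- Opposite quarter shifts keep `x + y` and add `1/2` to `x - y`.
  have h := theta_mul_theta hs (x + 1 / 4) (y - 1 / 4)
  rw [show x + 1 / 4 + (y - 1 / 4) = x + y by ring,
    show x + 1 / 4 - (y - 1 / 4) = x - y + 1 / 2 by ring,
    show 2 * (x + 1 / 4) = 2 * x + 1 / 2 by ring, show 2 * (y - 1 / 4) = 2 * y + 1 / 2 - 1 by ring,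
    show 2 * y + 1 / 2 - 1 + I * s = 2 * y + 1 / 2 + I * s - 1 by ring, theta_sub_one,
    theta_sub_one] at h
  exact h

/-- The reflected companion of `theta_mul_theta_half`. -/
theorem theta_mul_theta_half' {s : ℝ} (hs : 0 < s) (x y : ℂ) :
    theta s (x - y) * theta s (x + y + 1 / 2) =
      theta (2 * s) (2 * x + 1 / 2) * theta (2 * s) (2 * y + 1 / 2) -
      cexp (2 * Real.pi * I * (x + y) - Real.pi * s) *
        (theta (2 * s) (2 * x + 1 / 2 + I * s) * theta (2 * s) (2 * y + 1 / 2 + I * s)) := by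
  have h := theta_mul_theta_half hs x (-y)
  -- The shift by `1/2 + i s` is half a period in both directions for parameter `2s`, so up to an
  -- exponential this is the odd function `θ₁`. Its oddness supplies the minus sign.
  have e : theta (2 * s) (2 * -y + 1 / 2 + I * s) =
      -(cexp (4 * Real.pi * I * y) * theta (2 * s) (2 * y + 1 / 2 + I * s)) := by
    have e' := theta_add_period (2 * s) (-(2 * -y + 1 / 2 + I * s) + 1)
    rw [theta_add_one, theta_neg, show -(2 * -y + 1 / 2 + I * s) + 1 + I * (2 * s : ℝ) =
      2 * y + 1 / 2 + I * s by push_cast; ring] at e'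
    rw [e', ← mul_assoc, ← Complex.exp_add, show 4 * Real.pi * I * y + (Real.pi * (2 * s : ℝ) -
        2 * Real.pi * I * (-(2 * -y + 1 / 2 + I * s) + 1)) = -(Real.pi * I) by
        push_cast; linear_combination (2 * Real.pi * s : ℂ) * I_sq, Complex.exp_neg,
      Complex.exp_pi_mul_I]
    norm_num
  rw [show x + -y = x - y by ring, show x - -y = x + y by ring, e,
    show 2 * -y + 1 / 2 = -(2 * y) + 1 / 2 by ring, theta_half_sub] at h
  rw [h, show 2 * Real.pi * I * (x + y) - Real.pi * s =
    (2 * Real.pi * I * (x - y) - Real.pi * s) + 4 * Real.pi * I * y by ring, Complex.exp_add]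
  ring

/-- Duplication formula behind the addition theorem of `dn`. -/
theorem theta_cross_add {s : ℝ} (hs : 0 < s) (x y : ℂ) :
    theta s (x + y) * theta s (x - y + 1 / 2) + theta s (x - y) * theta s (x + y + 1 / 2) =
      2 * (theta (2 * s) (2 * x + 1 / 2) * theta (2 * s) (2 * y + 1 / 2)) := by
  rw [theta_mul_theta_half hs, theta_mul_theta_half' hs]
  ring

/-- The source of injectivity: equality of two values of `θ₃/θ₄` makes the left side zero, and the
zeros of the factors on the right are known. -/
theorem theta_cross_sub {s : ℝ} (hs : 0 < s) (x y : ℂ) :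
    theta s (x + y) * theta s (x - y + 1 / 2) - theta s (x - y) * theta s (x + y + 1 / 2) =
      2 * (cexp (2 * Real.pi * I * (x + y) - Real.pi * s) *
        (theta (2 * s) (2 * x + 1 / 2 + I * s) * theta (2 * s) (2 * y + 1 / 2 + I * s))) := by
  rw [theta_mul_theta_half hs, theta_mul_theta_half' hs]
  ring

/-- For real `x` and imaginary `y` the left side is `|θ(z)|² + |θ(z + 1/2)|²`, so the formula shows
that numerator and denominator have no common zero. -/
theorem theta_square_add {s : ℝ} (hs : 0 < s) (x y : ℂ) :
    theta s (x + y) * theta s (x - y) + theta s (x + y + 1 / 2) * theta s (x - y + 1 / 2) =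
      2 * (theta (2 * s) (2 * x) * theta (2 * s) (2 * y)) := by
  rw [theta_mul_theta hs, theta_half_mul_theta_half hs]
  ring

/-- The point equals its own negative modulo the lattice, and evenness combined with
quasi-periodicity gives the factor `-1` there. -/
theorem theta_half_period {s : ℝ} : theta s (1 / 2 + I * s / 2) = 0 := by
  have h := theta_add_period s (1 / 2 - I * s / 2)
  rw [show (1 / 2 - I * s / 2 : ℂ) + I * s = 1 / 2 + I * s / 2 by ring,
    show (1 / 2 - I * s / 2 : ℂ) = -(1 / 2 + I * s / 2) + 1 by ring, theta_add_one, theta_neg,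
    show (Real.pi * s - 2 * Real.pi * I * (-(1 / 2 + I * s / 2) + 1) : ℂ) = -(Real.pi * I) by
      linear_combination (Real.pi * s : ℂ) * I_sq, Complex.exp_neg, Complex.exp_pi_mul_I] at h
  have h' : 2 * theta s (1 / 2 + I * s / 2) = 0 := by linear_combination h
  simpa using h'

/-! ### Positivity -/

theorem theta_I_mul_pos {s : ℝ} (hs : 0 < s) (y : ℝ) : 0 < theta s (I * y) := by
  have e : ∀ n : ℤ, thetaTerm s (I * y) n =
      ((Real.exp (-2 * Real.pi * n * y - Real.pi * n ^ 2 * s) : ℝ) : ℂ) := fun n => by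
    rw [thetaTerm]
    push_cast
    congr 1
    linear_combination (2 * Real.pi * n * y : ℂ) * I_sq
  have hsum := summable_thetaTerm hs (I * y)
  rw [funext e] at hsum
  rw [theta_tsum, funext e, ← Complex.ofReal_tsum, Complex.zero_lt_real]
  exact (Complex.summable_ofReal.mp hsum).tsum_pos (fun _ => (Real.exp_pos _).le) 0
    (Real.exp_pos _)

theorem theta_modular {s : ℝ} (hs : 0 < s) (z : ℂ) :
    theta s z = ((1 / √s : ℝ) : ℂ) * cexp (-Real.pi * z ^ 2 / s) * theta (1 / s) (-I * z / s) := by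
  have hs' : (s : ℂ) ≠ 0 := by exact_mod_cast hs.ne'
  rw [theta, jacobiTheta₂_functional_equation, theta]
  have e1 : -I * (I * s) = (s : ℂ) := by linear_combination (-s : ℂ) * I_sq
  have e2 : (1 / (s : ℂ) ^ (1 / 2 : ℂ)) = ((1 / √s : ℝ) : ℂ) := by
    rw [Real.sqrt_eq_rpow]
    push_cast
    rw [Complex.ofReal_cpow hs.le]
    push_cast
    rfl
  have e3 : z / (I * s) = -I * z / s := by
    field_simp
    simp
  have e4 : -1 / (I * s) = I * ((1 / s : ℝ) : ℂ) := by
    push_cast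
    field_simp
    simp
  have e5 : -Real.pi * I * z ^ 2 / (I * s) = -Real.pi * z ^ 2 / s := by
    field_simp
  rw [e1, e2, e3, e4, e5]

/-- On the real axis the series oscillates; the modular transformation moves the point to the
imaginary axis, where every term is positive. -/
theorem theta_ofReal_pos {s : ℝ} (hs : 0 < s) (x : ℝ) : 0 < theta s x := by
  rw [theta_modular hs, show (-I * x / s : ℂ) = I * ((-x / s : ℝ) : ℂ) by push_cast; ring,
    show cexp (-Real.pi * x ^ 2 / s) = ((Real.exp (-Real.pi * x ^ 2 / s) : ℝ) : ℂ) by push_cast; rfl]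
  have h1 : (0 : ℂ) < ((1 / √s : ℝ) : ℂ) := by rw [Complex.zero_lt_real]; positivity
  have h2 : (0 : ℂ) < ((Real.exp (-Real.pi * x ^ 2 / s) : ℝ) : ℂ) := by
    rw [Complex.zero_lt_real]; positivity
  exact mul_pos (mul_pos h1 h2) (theta_I_mul_pos (by positivity) _)

end

section

open Complex ComplexOrder ComplexConjugate

theorem complex_pos_of_mul_pos {a b : ℂ} (ha : 0 < a) (hab : 0 < a * b) : 0 < b := by
  rw [Complex.pos_iff] at *
  have h1 : a.im = 0 := ha.2.symm
  simp only [Complex.mul_re, Complex.mul_im, h1, zero_mul, sub_zero, add_zero] at hab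
  refine ⟨(mul_pos_iff_of_pos_left ha.1).mp hab.1, ?_⟩
  rcases mul_eq_zero.mp hab.2.symm with h | h
  · exact absurd h ha.1.ne'
  · exact h.symm

/-- As a `t`-th power of a number that does not depend on `t`, the bound yields both termwise decay
and, for `t ≥ 1`, a fixed dominating series in `tendsto_theta_half`. -/
theorem norm_thetaTerm_half_le {s y t : ℝ} (ht : 0 ≤ t) (n : ℤ) :
    ‖thetaTerm (t * s) (I * (t * y : ℝ) + 1 / 2) n‖ ≤
      Real.exp (-Real.pi * n ^ 2 * (s - 2 * |y|)) ^ t := by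
  have e : (2 * Real.pi * I * n * (I * (t * y : ℝ) + 1 / 2) - Real.pi * n ^ 2 * (t * s : ℝ) : ℂ) =
      ((-(2 * Real.pi * n * (t * y)) - Real.pi * n ^ 2 * (t * s) : ℝ) : ℂ) +
        ((Real.pi * n : ℝ) : ℂ) * I := by
    push_cast
    linear_combination (2 * Real.pi * n * (t * y) : ℂ) * I_sq
  rw [thetaTerm, Complex.norm_exp, e, Complex.add_re, Complex.re_ofReal_mul, Complex.I_re,
    Complex.ofReal_re, ← Real.exp_mul, Real.exp_le_exp]
  have h1 : (|n| : ℝ) ≤ (n : ℝ) ^ 2 := by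
    have : |n| ≤ n ^ 2 := by rw [← sq_abs]; nlinarith [abs_nonneg n, Int.le_self_sq |n|]
    exact_mod_cast this
  have h2 : -(n * y) ≤ (n : ℝ) ^ 2 * |y| :=
    calc -(n * y : ℝ) ≤ |(n : ℝ) * y| := neg_le_abs _
      _ = |(n : ℝ)| * |y| := abs_mul _ _
      _ ≤ _ := by gcongr
  have h3 := mul_le_mul_of_nonneg_left h2 (mul_nonneg ht Real.pi_pos.le)
  nlinarith [h3]

theorem tendsto_theta_half {s y : ℝ} (hy : |y| < s / 2) :
    Tendsto (fun t : ℝ => theta (t * s) (I * (t * y : ℝ) + 1 / 2)) atTop (𝓝 1) := by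
  have hd : 0 < s - 2 * |y| := by linarith
  have hb : Summable fun n : ℤ => Real.exp (-Real.pi * n ^ 2 * (s - 2 * |y|)) := by
    refine (summable_thetaTerm hd 0).norm.congr fun n => ?_
    rw [thetaTerm, Complex.norm_exp]
    congr 1
    rw [show (2 * Real.pi * I * n * 0 - Real.pi * n ^ 2 * (s - 2 * |y| : ℝ) : ℂ) =
      ((-Real.pi * n ^ 2 * (s - 2 * |y|) : ℝ) : ℂ) by push_cast; ring, Complex.ofReal_re]
  have h1 : ∑' n : ℤ, (if n = 0 then (1 : ℂ) else 0) = 1 := by simp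
  simp only [theta_tsum]
  suffices h : Tendsto (fun t : ℝ => ∑' n : ℤ, thetaTerm (t * s) (I * (t * y : ℝ) + 1 / 2) n) atTop
      (𝓝 (∑' n : ℤ, (if n = 0 then (1 : ℂ) else 0))) by rwa [h1] at h
  refine tendsto_tsum_of_dominated_convergence hb (fun n => ?_) ?_
  · by_cases hn : n = 0
    · simp [hn, thetaTerm]
    · simp only [hn, if_false]
      rw [tendsto_zero_iff_norm_tendsto_zero]
      have hlt : Real.exp (-Real.pi * n ^ 2 * (s - 2 * |y|)) < 1 := by
        rw [Real.exp_lt_one_iff]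
        have : (n : ℝ) ≠ 0 := by exact_mod_cast hn
        have : 0 < Real.pi * (n : ℝ) ^ 2 * (s - 2 * |y|) := by positivity
        linarith
      refine squeeze_zero' (Eventually.of_forall fun t => norm_nonneg _) ?_
        (tendsto_rpow_atTop_of_base_lt_one _ (neg_one_lt_zero.trans (Real.exp_pos _)) hlt)
      filter_upwards [eventually_ge_atTop 0] with t ht
      exact norm_thetaTerm_half_le ht n
  · filter_upwards [eventually_ge_atTop 1] with t ht n
    refine (norm_thetaTerm_half_le (by linarith) n).trans ?_
    refine (Real.rpow_le_rpow_of_exponent_ge (Real.exp_pos _) ?_ ht).trans_eq (Real.rpow_one _)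
    rw [Real.exp_le_one_iff]
    have : 0 ≤ Real.pi * (n : ℝ) ^ 2 * (s - 2 * |y|) := by positivity
    linarith

theorem conj_half : conj (1 / 2 : ℂ) = 1 / 2 := by
  simpa using Complex.conj_ofReal (1 / 2)

theorem theta_I_mul_add_half_im (s y : ℝ) : (theta s (I * y + 1 / 2)).im = 0 := by
  rw [← Complex.conj_eq_iff_im, conj_theta, ← theta_half_sub]
  rw [map_add, conj_half]
  simp

theorem theta_half_duplication {s : ℝ} (hs : 0 < s) (z : ℂ) :
    theta s z * theta s (z + 1 / 2) = theta (2 * s) (2 * z + 1 / 2) * theta (2 * s) (1 / 2) := by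
  have h := theta_cross_add hs z 0
  simp only [add_zero, sub_zero, mul_zero, zero_add] at h
  linear_combination h / 2

theorem theta_half_pos {s : ℝ} (hs : 0 < s) : 0 < theta s (1 / 2) := by
  simpa using theta_ofReal_pos hs (1 / 2)

/-- Duplication reduces the sign at `(s, y)` to the sign at `(2s, 2y)`, the other factors being
positive. The condition on `|y|/s` is preserved, and after many doublings the value is close to `1`.
-/
theorem theta_I_mul_add_half_pos {s y : ℝ} (hy : |y| < s / 2) : 0 < theta s (I * y + 1 / 2) := by
  have step : ∀ (N : ℕ) {s y : ℝ}, |y| < s / 2 →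
      0 < theta (2 ^ N * s) (I * (2 ^ N * y : ℝ) + 1 / 2) → 0 < theta s (I * y + 1 / 2) := by
    intro N
    induction N with
    | zero => intro s y _ h; simpa using h
    | succ N ih =>
      intro s y hy h
      have hs : 0 < s := by linarith [abs_nonneg y]
      refine complex_pos_of_mul_pos (theta_I_mul_pos hs y) ?_
      rw [theta_half_duplication hs]
      refine mul_pos ?_ (theta_half_pos (by positivity))
      have h2 := ih (s := 2 * s) (y := 2 * y) (by rw [abs_mul, abs_two]; linarith)
        (by convert h using 2 <;> (try push_cast) <;> ring)
      convert h2 using 2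
      push_cast; ring
  have hlim := (tendsto_theta_half hy).comp (tendsto_pow_atTop_atTop_of_one_lt (one_lt_two (α := ℝ)))
  have hre := (Complex.continuous_re.tendsto 1).comp hlim
  obtain ⟨N, hN⟩ := (hre.eventually_const_lt (show (0 : ℝ) < (1 : ℂ).re by simp)).exists
  refine step N hy (Complex.pos_iff.mpr ⟨hN, (theta_I_mul_add_half_im _ _).symm⟩)

/-! ### Zeros -/

/-- Taking `x = Re z` and `y = i Im z` in the addition formula separates real and imaginary parts.
The factor in `Re z` is always positive, so the sign depends on `Im z` only. -/
theorem theta_mul_conj_theta_half {s : ℝ} (hs : 0 < s) (z : ℂ) :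
    theta s z * conj (theta s (z + 1 / 2)) + conj (theta s z) * theta s (z + 1 / 2) =
      2 * (theta (2 * s) (2 * z.re + 1 / 2) * theta (2 * s) (I * (2 * z.im : ℝ) + 1 / 2)) := by
  have e1 : (z.re : ℂ) + I * z.im = z := by rw [mul_comm I, Complex.re_add_im]
  have e2 : (z.re : ℂ) - I * z.im = conj z := by
    rw [Complex.ext_iff]; simp
  have h := theta_cross_add hs z.re (I * z.im)
  rw [e1, e2] at h
  rw [conj_theta, conj_theta, map_add, conj_half, h]
  push_cast
  ring_nf

theorem ofReal_re_theta_mul_conj {s : ℝ} (hs : 0 < s) (z : ℂ) :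
    (((theta s z * conj (theta s (z + 1 / 2))).re : ℝ) : ℂ) =
      theta (2 * s) (2 * z.re + 1 / 2) * theta (2 * s) (I * (2 * z.im : ℝ) + 1 / 2) := by
  have h := theta_mul_conj_theta_half hs z
  have h2 := Complex.add_conj (theta s z * conj (theta s (z + 1 / 2)))
  rw [map_mul, Complex.conj_conj, h] at h2
  push_cast at h2 ⊢
  linear_combination -h2 / 2

theorem re_theta_mul_conj_pos {s : ℝ} {z : ℂ} (hz : |z.im| < s / 2) :
    0 < (theta s z * conj (theta s (z + 1 / 2))).re := by
  have hs : 0 < s := by linarith [abs_nonneg z.im]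
  have h1 := theta_ofReal_pos (s := 2 * s) (by positivity) (2 * z.re + 1 / 2)
  have h2 := theta_I_mul_add_half_pos (s := 2 * s) (y := 2 * z.im)
    (by rw [abs_mul, abs_two]; linarith)
  rw [← Complex.zero_lt_real, ofReal_re_theta_mul_conj hs]
  push_cast at h1 h2 ⊢
  exact mul_pos h1 h2

theorem re_theta_mul_conj_eq_zero {s : ℝ} (hs : 0 < s) {z : ℂ} (hz : |z.im| = s / 2) :
    (theta s z * conj (theta s (z + 1 / 2))).re = 0 := by
  rw [← Complex.ofReal_eq_zero, ofReal_re_theta_mul_conj hs, mul_eq_zero]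
  right
  rcases abs_choice z.im with h | h
  · rw [← theta_half_period (s := 2 * s), show z.im = s / 2 by linarith]
    congr 1; push_cast; ring
  · rw [← theta_half_period (s := 2 * s), show z.im = -(s / 2) by linarith, add_comm (1 / 2 : ℂ),
      ← theta_half_sub]
    congr 1; push_cast; ring

theorem normSq_theta_add_pos {s : ℝ} (hs : 0 < s) (z : ℂ) :
    0 < normSq (theta s z) + normSq (theta s (z + 1 / 2)) := by
  have e1 : (z.re : ℂ) + I * z.im = z := by rw [mul_comm I, Complex.re_add_im]
  have e2 : (z.re : ℂ) - I * z.im = conj z := by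
    rw [Complex.ext_iff]; simp
  have h := theta_square_add hs z.re (I * z.im)
  have h1 := theta_ofReal_pos (s := 2 * s) (by positivity) (2 * z.re)
  have h2 := theta_I_mul_pos (s := 2 * s) (by positivity) (2 * z.im)
  rw [e1, e2, ← conj_theta, show conj z + 1 / 2 = conj (z + 1 / 2) by rw [map_add, conj_half],
    ← conj_theta,
    Complex.mul_conj, Complex.mul_conj] at h
  rw [← Complex.zero_lt_real]
  push_cast at h1 h2 ⊢
  rw [h, show (2 * (I * z.im) : ℂ) = I * (2 * z.im) by ring]
  exact mul_pos two_pos (mul_pos h1 h2)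

theorem theta_ne_zero {s : ℝ} {z : ℂ} (hz : |z.im| < s / 2) : theta s z ≠ 0 := by
  intro h
  have := re_theta_mul_conj_pos hz
  simp [h] at this

/-- If `Im v ≠ 0`, the point or its translate by `-i s` lies in the zero-free strip. If `v` is real,
the modular transformation maps the point to the segment where `theta_I_mul_add_half_pos` applies,
unless `v` is an integer. -/
theorem theta_eq_zero_imp_int {s : ℝ} {v : ℂ} (hv : |v.im| < s)
    (h : theta s (v + 1 / 2 + I * s / 2) = 0) : ∃ n : ℤ, v = n := by
  have hs : 0 < s := by linarith [abs_nonneg v.im]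
  have hlow : theta s (v + 1 / 2 - I * s / 2) = 0 := by
    have h' := theta_add_period s (v + 1 / 2 - I * s / 2)
    rw [show v + 1 / 2 - I * s / 2 + I * s = v + 1 / 2 + I * s / 2 by ring, h] at h'
    exact (mul_eq_zero.mp h'.symm).resolve_left (Complex.exp_ne_zero _)
  have im1 : (v + 1 / 2 + I * s / 2).im = v.im + s / 2 := by simp
  have im2 : (v + 1 / 2 - I * s / 2).im = v.im - s / 2 := by simp
  rw [abs_lt] at hv
  rcases lt_trichotomy v.im 0 with h0 | h0 | h0
  · exact absurd h (theta_ne_zero (by rw [im1, abs_lt]; constructor <;> linarith))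
  · have hvr : v = (v.re : ℂ) := by rw [Complex.ext_iff]; simp [h0]
    by_contra hn
    -- The fractional part lies in `(0, 1)`, which is exactly `|x - 1/2| < 1/2`, as needed for
    -- positivity at parameter `1/s`.
    set x : ℝ := Int.fract v.re with hx
    have hx0 : 0 < x := by
      refine lt_of_le_of_ne (Int.fract_nonneg _) fun h' => hn ⟨⌊v.re⌋, ?_⟩
      rw [hvr]
      have := Int.floor_add_fract v.re
      rw [← hx, ← h', add_zero] at this
      exact_mod_cast this.symm
    have hx1 : x < 1 := Int.fract_lt_one _
    have h1 : theta s (x + 1 / 2 + I * s / 2) = 0 := by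
      rw [← theta_add_int s _ ⌊v.re⌋, ← h]
      congr 1
      have hvx : v = (⌊v.re⌋ : ℂ) + x := by
        rw [hvr, hx]
        exact_mod_cast (Int.floor_add_fract v.re).symm
      linear_combination -hvx
    rw [theta_modular hs, mul_eq_zero, or_iff_right] at h1
    · have h2 := theta_I_mul_add_half_pos (s := 1 / s) (y := -(x - 1 / 2) / s) (by
        rw [abs_div, abs_neg, abs_of_pos hs, div_lt_iff₀ hs, abs_lt]
        have : 1 / s / 2 * s = 1 / 2 := by field_simp
        rw [this]; constructor <;> linarith)
      have hs' : (s : ℂ) ≠ 0 := by exact_mod_cast hs.ne'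
      have h3 := theta_add_period (1 / s) (-I * (x + 1 / 2 + I * s / 2) / s)
      rw [h1, mul_zero, show -I * (x + 1 / 2 + I * s / 2) / s + I * (1 / s : ℝ) =
        I * (-(x - 1 / 2) / s : ℝ) + 1 / 2 by
          push_cast; field_simp; linear_combination (-s : ℂ) * I_sq] at h3
      exact h2.ne' h3
    · exact mul_ne_zero (by exact_mod_cast (by positivity : (1 / √s) ≠ 0)) (Complex.exp_ne_zero _)
  · exact absurd hlow (theta_ne_zero (by rw [im2, abs_lt]; constructor <;> linarith))

/-- The quotient `θ₃ / θ₄` separates points of the strip up to sign and integer shifts. -/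
theorem theta_cross_eq_imp {s : ℝ} {z w : ℂ} (hz : |z.im| < s / 2) (hw : |w.im| < s / 2)
    (h : theta s z * theta s (w + 1 / 2) = theta s w * theta s (z + 1 / 2)) :
    ∃ n : ℤ, z = w + n ∨ z = -w + n := by
  have hs : 0 < s := by linarith [abs_nonneg z.im]
  -- Half-sum and half-difference make the arguments on the left `z` and `w`, and those on the right
  -- `z ± w`, up to the half-period.
  have h1 := theta_cross_sub hs ((z + w) / 2) ((z - w) / 2)
  rw [show (z + w) / 2 + (z - w) / 2 = z by ring, show (z + w) / 2 - (z - w) / 2 = w by ring,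
    h, sub_self] at h1
  have h2 := (mul_eq_zero.mp ((mul_eq_zero.mp h1.symm).resolve_left two_ne_zero)).resolve_left
    (Complex.exp_ne_zero _)
  rw [abs_lt] at hz hw
  rcases mul_eq_zero.mp h2 with h3 | h3
  · obtain ⟨n, hn⟩ := theta_eq_zero_imp_int (s := 2 * s) (v := z + w)
      (by rw [Complex.add_im, abs_lt]; constructor <;> linarith) (by
        rw [← h3]; congr 1; push_cast; ring)
    exact ⟨n, Or.inr (by linear_combination hn)⟩
  · obtain ⟨n, hn⟩ := theta_eq_zero_imp_int (s := 2 * s) (v := z - w)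
      (by rw [Complex.sub_im, abs_lt]; constructor <;> linarith) (by
        rw [← h3]; congr 1; push_cast; ring)
    exact ⟨n, Or.inl (by linear_combination hn)⟩

/-! ### Values at `0` -/

theorem theta_zero_sq_add {s : ℝ} (hs : 0 < s) :
    theta s 0 ^ 2 + theta s (1 / 2) ^ 2 = 2 * theta (2 * s) 0 ^ 2 := by
  have h := theta_square_add hs 0 0
  simp only [add_zero, sub_zero, mul_zero, zero_add] at h
  linear_combination h

theorem theta_zero_mul {s : ℝ} (hs : 0 < s) :
    theta s 0 * theta s (1 / 2) = theta (2 * s) (1 / 2) ^ 2 := by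
  have h := theta_half_duplication hs 0
  simp only [mul_zero, zero_add] at h
  linear_combination h

/-- Jacobi's quartic identity, with `θ₂` written through the modular transformation. -/
theorem theta_quartic {s : ℝ} (hs : 0 < s) :
    theta s 0 ^ 4 = theta s (1 / 2) ^ 4 + (theta (1 / s) (1 / 2) / √s) ^ 4 := by
  have hs' : (s : ℂ) ≠ 0 := by exact_mod_cast hs.ne'
  -- The right side is `θ₂(0)⁴`, as `θ₂(0) = exp (-π s/4) θ(i s/2)`.
  have key : theta s 0 ^ 4 - theta s (1 / 2) ^ 4 =
      cexp (-Real.pi * s) * theta s (I * s / 2) ^ 4 := by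
    have h1 := theta_square_add hs (I * s / 2) 0
    have h2 := theta_mul_theta hs 0 0
    have h3 := theta_half_mul_theta_half hs 0 0
    simp only [add_zero, sub_zero, mul_zero, zero_add] at h1 h2 h3
    rw [add_comm (I * s / 2), theta_half_period, show 2 * (I * s / 2 : ℂ) = I * s by ring] at h1
    have h4 := theta_zero_sq_add hs
    have e : cexp (0 - Real.pi * s) = cexp (-Real.pi * s) := by congr 1; ring
    rw [e] at h2 h3
    have h5 : theta s 0 ^ 2 - theta s (1 / 2) ^ 2 =
      2 * (cexp (-Real.pi * s) * theta (2 * s) (I * s) ^ 2) := by linear_combination h2 - h3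
    have h6 : theta s (I * s / 2) ^ 2 = 2 * (theta (2 * s) (I * s) * theta (2 * s) 0) := by
      linear_combination h1
    linear_combination (theta s 0 ^ 2 - theta s (1 / 2) ^ 2) * h4 +
      2 * theta (2 * s) 0 ^ 2 * h5 - cexp (-Real.pi * s) * (theta s (I * s / 2) ^ 2 +
        2 * (theta (2 * s) (I * s) * theta (2 * s) 0)) * h6
  have h1 := theta_modular hs (I * s / 2)
  rw [show -I * (I * s / 2) / s = (1 / 2 : ℂ) by
      field_simp; linear_combination -I_sq] at h1
  rw [h1] at key
  have e2 : cexp (-Real.pi * s) * cexp (-Real.pi * (I * s / 2) ^ 2 / s) ^ 4 = 1 := by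
    rw [← Complex.exp_nat_mul, ← Complex.exp_add, Complex.exp_eq_one_iff]
    refine ⟨0, ?_⟩
    field_simp
    push_cast
    linear_combination (-4 * s : ℂ) * I_sq
  push_cast at key
  linear_combination key + (theta (1 / s) (1 / 2) / √s) ^ 4 * e2

end

/-! ### Gauss's transformation of the complete elliptic integral -/

/-- Gauss's integral, the reciprocal of the arithmetic-geometric mean up to the factor `π / 2`. -/
def gaussInt (a b : ℝ) : ℝ :=
  ∫ θ in (0 : ℝ)..(Real.pi / 2), 1 / √(a ^ 2 * Real.cos θ ^ 2 + b ^ 2 * Real.sin θ ^ 2)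

theorem ellipticK_eq_gaussInt {k : ℝ} (hk : k ^ 2 ≤ 1) : ellipticK k = gaussInt 1 √(1 - k ^ 2) := by
  unfold ellipticK gaussInt
  congr 1
  ext θ
  rw [Real.sq_sqrt (by linarith), Real.cos_sq']
  ring_nf

theorem gaussInt_mul {c : ℝ} (hc : 0 < c) (a b : ℝ) :
    gaussInt (c * a) (c * b) = gaussInt a b / c := by
  unfold gaussInt
  rw [← intervalIntegral.integral_div]
  congr 1
  ext θ
  rw [show (c * a) ^ 2 * Real.cos θ ^ 2 + (c * b) ^ 2 * Real.sin θ ^ 2 =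
    c ^ 2 * (a ^ 2 * Real.cos θ ^ 2 + b ^ 2 * Real.sin θ ^ 2) by ring,
    Real.sqrt_mul (by positivity), Real.sqrt_sq hc.le, div_div, mul_comm c]

theorem sq_mul_cos_add_sq_mul_sin_bounds {m M a b : ℝ} (hm : 0 < m) (ha : m ≤ a) (hb : m ≤ b)
    (ha' : a ≤ M) (hb' : b ≤ M) (θ : ℝ) :
    m ^ 2 ≤ a ^ 2 * Real.cos θ ^ 2 + b ^ 2 * Real.sin θ ^ 2 ∧
      a ^ 2 * Real.cos θ ^ 2 + b ^ 2 * Real.sin θ ^ 2 ≤ M ^ 2 := by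
  have h := Real.sin_sq_add_cos_sq θ
  constructor
  · calc m ^ 2 = m ^ 2 * Real.cos θ ^ 2 + m ^ 2 * Real.sin θ ^ 2 := by
          linear_combination -m ^ 2 * h
      _ ≤ _ := by gcongr
  · calc _ ≤ M ^ 2 * Real.cos θ ^ 2 + M ^ 2 * Real.sin θ ^ 2 := by
          have : 0 ≤ a := by linarith
          have : 0 ≤ b := by linarith
          gcongr
      _ = M ^ 2 := by linear_combination M ^ 2 * h

theorem continuous_gaussInt_integrand {a b : ℝ} (ha : 0 < a) (hb : 0 < b) :
    Continuous fun θ => 1 / √(a ^ 2 * Real.cos θ ^ 2 + b ^ 2 * Real.sin θ ^ 2) := by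
  refine continuous_const.div (by fun_prop) fun θ => (Real.sqrt_pos.mpr ?_).ne'
  exact lt_of_lt_of_le (by positivity) (sq_mul_cos_add_sq_mul_sin_bounds (lt_min ha hb)
    (min_le_left a b) (min_le_right a b) (le_max_left a b) (le_max_right a b) θ).1

theorem gaussInt_bounds {m M a b : ℝ} (hm : 0 < m) (ha : m ≤ a) (hb : m ≤ b)
    (ha' : a ≤ M) (hb' : b ≤ M) :
    Real.pi / 2 * (1 / M) ≤ gaussInt a b ∧ gaussInt a b ≤ Real.pi / 2 * (1 / m) := by
  have hi := (continuous_gaussInt_integrand (hm.trans_le ha) (hm.trans_le hb)).intervalIntegrable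
    (μ := MeasureTheory.volume) 0 (Real.pi / 2)
  have hM : 0 < M := by linarith
  have hpi : (0 : ℝ) ≤ Real.pi / 2 := by positivity
  have e : ∀ c : ℝ, ∫ _ in (0 : ℝ)..(Real.pi / 2), c = Real.pi / 2 * c := fun c => by simp
  have hb := sq_mul_cos_add_sq_mul_sin_bounds hm ha hb ha' hb'
  constructor
  · rw [← e]
    refine intervalIntegral.integral_mono_on hpi (by simp) hi fun θ _ => ?_
    refine one_div_le_one_div_of_le (Real.sqrt_pos.mpr (lt_of_lt_of_le (by positivity) (hb θ).1)) ?_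
    exact Real.sqrt_le_iff.mpr ⟨hM.le, (hb θ).2⟩
  · rw [← e]
    refine intervalIntegral.integral_mono_on hpi hi (by simp) fun θ _ => ?_
    exact one_div_le_one_div_of_le hm (Real.le_sqrt_of_sq_le (hb θ).1)

theorem gaussInt_eq_integral_Ioi {a b : ℝ} (ha : 0 < a) (hb : 0 < b) :
    gaussInt a b = ∫ t in Ioi (0 : ℝ), 1 / √((a ^ 2 + t ^ 2) * (b ^ 2 + t ^ 2)) := by
  have himg : (fun θ => b * Real.tan θ) '' Ioo 0 (Real.pi / 2) = Ioi 0 := by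
    ext t
    simp only [mem_image, mem_Ioo, mem_Ioi]
    constructor
    · rintro ⟨θ, ⟨h0, h1⟩, rfl⟩
      exact mul_pos hb (Real.tan_pos_of_pos_of_lt_pi_div_two h0 h1)
    · intro ht
      refine ⟨Real.arctan (t / b), ⟨Real.arctan_pos.mpr (by positivity),
        Real.arctan_lt_pi_div_two _⟩, ?_⟩
      rw [Real.tan_arctan]; field_simp
  have hcos : ∀ θ ∈ Ioo 0 (Real.pi / 2), 0 < Real.cos θ := fun θ hθ =>
    Real.cos_pos_of_mem_Ioo ⟨by linarith [hθ.1, Real.pi_pos], hθ.2⟩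
  have hderiv : ∀ θ ∈ Ioo 0 (Real.pi / 2), HasDerivWithinAt (fun θ => b * Real.tan θ)
      (b * (1 / Real.cos θ ^ 2)) (Ioo 0 (Real.pi / 2)) θ := fun θ hθ =>
    ((Real.hasDerivAt_tan (hcos θ hθ).ne').const_mul b).hasDerivWithinAt
  have hinj : InjOn (fun θ => b * Real.tan θ) (Ioo 0 (Real.pi / 2)) := by
    intro x hx y hy h
    exact Real.injOn_tan ⟨by linarith [hx.1, Real.pi_pos], hx.2⟩
      ⟨by linarith [hy.1, Real.pi_pos], hy.2⟩ (mul_left_cancel₀ hb.ne' h)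
  rw [← himg, MeasureTheory.integral_image_eq_integral_abs_deriv_smul measurableSet_Ioo hderiv hinj,
    gaussInt, intervalIntegral.integral_of_le (by positivity),
    MeasureTheory.integral_Ioc_eq_integral_Ioo]
  refine MeasureTheory.setIntegral_congr_fun measurableSet_Ioo fun θ hθ => ?_
  have hc := hcos θ hθ
  have hsc := Real.sin_sq_add_cos_sq θ
  have hpos : 0 ≤ a ^ 2 * Real.cos θ ^ 2 + b ^ 2 * Real.sin θ ^ 2 := by positivity
  have e : (a ^ 2 + (b * Real.tan θ) ^ 2) * (b ^ 2 + (b * Real.tan θ) ^ 2) =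
      (b / Real.cos θ ^ 2) ^ 2 * (a ^ 2 * Real.cos θ ^ 2 + b ^ 2 * Real.sin θ ^ 2) := by
    rw [Real.tan_eq_sin_div_cos]
    field_simp
    linear_combination hsc
  simp only [smul_eq_mul]
  rw [e, Real.sqrt_mul (by positivity), Real.sqrt_sq (by positivity), abs_of_pos (by positivity)]
  field_simp

/-- One step of the arithmetic-geometric mean leaves the integral unchanged. The substitution `u =
(t - ab/t)/2` maps `(0, ∞)` bijectively to `ℝ`, and the integrand in `u` is even. -/
theorem gaussInt_landen {a b : ℝ} (ha : 0 < a) (hb : 0 < b) :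
    gaussInt ((a + b) / 2) √(a * b) = gaussInt a b := by
  have hab : 0 < a * b := mul_pos ha hb
  rw [gaussInt_eq_integral_Ioi ha hb, gaussInt_eq_integral_Ioi (by positivity) (by positivity),
    Real.sq_sqrt hab.le]
  have heven := integral_comp_abs
    (f := fun t => 1 / √((((a + b) / 2) ^ 2 + t ^ 2) * (a * b + t ^ 2)))
  simp only [sq_abs] at heven
  have himg : (fun t => (t - a * b / t) / 2) '' Ioi 0 = univ := by
    refine eq_univ_of_forall fun u => ?_
    have h1 : 0 ≤ u ^ 2 + a * b := by positivity
    have h2 : |u| < √(u ^ 2 + a * b) := by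
      rw [← Real.sqrt_sq_eq_abs]; exact Real.sqrt_lt_sqrt (sq_nonneg u) (by linarith)
    have h3 : 0 < u + √(u ^ 2 + a * b) := by linarith [neg_abs_le u]
    -- The positive root of `t² - 2ut - ab = 0`.
    refine ⟨u + √(u ^ 2 + a * b), h3, ?_⟩
    have h4 := Real.sq_sqrt h1
    simp only
    field_simp
    linear_combination h4
  have hderiv : ∀ t ∈ Ioi (0 : ℝ), HasDerivWithinAt (fun t => (t - a * b / t) / 2)
      ((1 + a * b / t ^ 2) / 2) (Ioi 0) t := fun t ht => by
    have ht' : t ≠ 0 := (mem_Ioi.mp ht).ne'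
    have := ((hasDerivAt_id t).sub ((hasDerivAt_inv ht').const_mul (a * b))).div_const 2
    refine (this.congr_deriv ?_).hasDerivWithinAt
    field_simp
    ring
  have hinj : InjOn (fun t => (t - a * b / t) / 2) (Ioi 0) := by
    intro x hx y hy h
    have hx' : 0 < x := hx
    have hy' : 0 < y := hy
    simp only at h
    field_simp at h
    have h' : (x - y) * (x * y + a * b) = 0 := by linear_combination h
    rcases mul_eq_zero.mp h' with h0 | h0
    · linarith
    · have : 0 < x * y := mul_pos hx' hy'
      linarith
  have hsub := MeasureTheory.integral_image_eq_integral_abs_deriv_smul measurableSet_Ioi hderiv hinj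
    (fun t => 1 / √((((a + b) / 2) ^ 2 + t ^ 2) * (a * b + t ^ 2)))
  rw [himg, MeasureTheory.setIntegral_univ, heven] at hsub
  have hR : ∫ t in Ioi (0 : ℝ), |(1 + a * b / t ^ 2) / 2| •
      (1 / √((((a + b) / 2) ^ 2 + ((t - a * b / t) / 2) ^ 2) *
        (a * b + ((t - a * b / t) / 2) ^ 2))) =
      ∫ t in Ioi (0 : ℝ), 2 * (1 / √((a ^ 2 + t ^ 2) * (b ^ 2 + t ^ 2))) := by
    refine MeasureTheory.setIntegral_congr_fun measurableSet_Ioi fun t ht => ?_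
    have ht' : 0 < t := ht
    have e : (((a + b) / 2) ^ 2 + ((t - a * b / t) / 2) ^ 2) *
        (a * b + ((t - a * b / t) / 2) ^ 2) =
        ((1 + a * b / t ^ 2) / 4) ^ 2 * ((a ^ 2 + t ^ 2) * (b ^ 2 + t ^ 2)) := by
      field_simp
      ring
    simp only [smul_eq_mul]
    rw [e, Real.sqrt_mul (by positivity), Real.sqrt_sq (by positivity), abs_of_pos (by positivity)]
    have : 0 < √((a ^ 2 + t ^ 2) * (b ^ 2 + t ^ 2)) := Real.sqrt_pos.mpr (by positivity)
    field_simp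
    norm_num
  rw [hR, MeasureTheory.integral_const_mul] at hsub
  linarith

/-! ### Positivity and monotonicity of the complete elliptic integral -/

theorem ellipticK_pos {k : ℝ} (hk : k ^ 2 < 1) : 0 < ellipticK k := by
  rw [ellipticK_eq_gaussInt hk.le]
  have h : 0 < √(1 - k ^ 2) := Real.sqrt_pos.mpr (by linarith)
  refine lt_of_lt_of_le ?_ (gaussInt_bounds (lt_min one_pos h) (min_le_left _ _) (min_le_right _ _)
    (le_max_left _ _) (le_max_right _ _)).1
  have : 0 < max 1 √(1 - k ^ 2) := lt_max_of_lt_left one_pos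
  positivity

theorem ellipticK_strictMono {k l : ℝ} (hk : 0 ≤ k) (hkl : k < l) (hl : l < 1) :
    ellipticK k < ellipticK l := by
  have hpi := Real.pi_pos
  have hpos : ∀ m : ℝ, 0 ≤ m → m < 1 → ∀ θ, 0 < 1 - m ^ 2 * Real.sin θ ^ 2 := fun m h0 h1 θ => by
    have := Real.sin_sq_le_one θ
    nlinarith [sq_nonneg (Real.sin θ), sq_nonneg m]
  have hc : ∀ m : ℝ, 0 ≤ m → m < 1 → Continuous fun θ => 1 / √(1 - m ^ 2 * Real.sin θ ^ 2) :=
    fun m h0 h1 => continuous_const.div (by fun_prop)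
      fun θ => (Real.sqrt_pos.mpr (hpos m h0 h1 θ)).ne'
  have hl0 : 0 ≤ l := hk.trans hkl.le
  have hkl2 : k ^ 2 < l ^ 2 := by nlinarith
  refine intervalIntegral.integral_lt_integral_of_continuousOn_of_le_of_exists_lt (by positivity)
    (hc k hk (hkl.trans hl)).continuousOn (hc l hl0 hl).continuousOn (fun θ _ => ?_)
    ⟨Real.pi / 2, ⟨by positivity, le_rfl⟩, ?_⟩
  · refine one_div_le_one_div_of_le (Real.sqrt_pos.mpr (hpos l hl0 hl θ)) (Real.sqrt_le_sqrt ?_)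
    have := mul_le_mul_of_nonneg_right hkl2.le (sq_nonneg (Real.sin θ))
    linarith
  · refine one_div_lt_one_div_of_lt (Real.sqrt_pos.mpr (hpos l hl0 hl _))
      (Real.sqrt_lt_sqrt (hpos l hl0 hl _).le ?_)
    rw [Real.sin_pi_div_two]
    linarith

/-- The ratio `K(k') / K(k)` determines the modulus. -/
theorem ellipticK_ratio_strictMono {k l : ℝ} (hk : 0 < k) (hkl : k < l) (hl : l < 1) :
    ellipticK k / ellipticK √(1 - k ^ 2) < ellipticK l / ellipticK √(1 - l ^ 2) := by
  have hl0 : 0 < l := hk.trans hkl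
  have hkl2 : k ^ 2 < l ^ 2 := by nlinarith
  have hl2 : l ^ 2 < 1 := by nlinarith
  have h1 : √(1 - l ^ 2) < √(1 - k ^ 2) := Real.sqrt_lt_sqrt (by linarith) (by linarith)
  have h2 : √(1 - k ^ 2) < 1 := by
    rw [Real.sqrt_lt' one_pos]; nlinarith
  have h3 := ellipticK_strictMono (Real.sqrt_nonneg _) h1 h2
  have h4 := ellipticK_strictMono hk.le hkl hl
  have h5 : 0 < ellipticK √(1 - l ^ 2) := ellipticK_pos (by
    rw [Real.sq_sqrt (by linarith)]; nlinarith)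
  have h6 : 0 < ellipticK k := ellipticK_pos (by linarith)
  rw [div_lt_div_iff₀ (h5.trans h3) h5]
  exact mul_lt_mul h4 h3.le h5 (h6.trans h4).le

/-! ### Theta constants and the complete elliptic integral -/

theorem ofReal_re_theta_zero {s : ℝ} (hs : 0 < s) : (((theta s 0).re : ℝ) : ℂ) = theta s 0 := by
  have h := theta_ofReal_pos hs 0
  rw [Complex.ofReal_zero, Complex.pos_iff] at h
  rw [Complex.ext_iff]
  exact ⟨rfl, h.2⟩

theorem ofReal_re_theta_half {s : ℝ} (hs : 0 < s) :
    (((theta s (1 / 2)).re : ℝ) : ℂ) = theta s (1 / 2) := by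
  have h := theta_half_pos hs
  rw [Complex.pos_iff] at h
  rw [Complex.ext_iff]
  exact ⟨rfl, h.2⟩

theorem re_theta_zero_pos {s : ℝ} (hs : 0 < s) : 0 < (theta s 0).re := by
  simpa using (Complex.pos_iff.mp (theta_ofReal_pos hs 0)).1

theorem re_theta_half_pos {s : ℝ} (hs : 0 < s) : 0 < (theta s (1 / 2)).re :=
  (Complex.pos_iff.mp (theta_half_pos hs)).1

/-- Doubling `s` replaces `(θ₃(0)², θ₄(0)²)` by its arithmetic and geometric means. -/
theorem gaussInt_theta_double {s : ℝ} (hs : 0 < s) :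
    gaussInt ((theta (2 * s) 0).re ^ 2) ((theta (2 * s) (1 / 2)).re ^ 2) =
      gaussInt ((theta s 0).re ^ 2) ((theta s (1 / 2)).re ^ 2) := by
  have h2 : 0 < 2 * s := by positivity
  have p0 := re_theta_zero_pos hs
  have p1 := re_theta_half_pos hs
  have e0 := theta_zero_sq_add hs
  have e1 := theta_zero_mul hs
  rw [← ofReal_re_theta_zero hs, ← ofReal_re_theta_half hs] at e0 e1
  rw [← ofReal_re_theta_zero h2] at e0
  rw [← ofReal_re_theta_half h2] at e1
  norm_cast at e0 e1
  rw [← gaussInt_landen (a := (theta s 0).re ^ 2) (by positivity) (by positivity), e0, ← mul_pow, e1,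
    Real.sqrt_sq (sq_nonneg _), mul_div_cancel_left₀ _ two_ne_zero]

/-- Under repeated doubling of `s` both arguments tend to `1` while the integral stays fixed, so it
is squeezed to `π/2`. -/
theorem gaussInt_theta {s : ℝ} (hs : 0 < s) :
    gaussInt ((theta s 0).re ^ 2) ((theta s (1 / 2)).re ^ 2) = Real.pi / 2 := by
  set a : ℕ → ℝ := fun N => (theta (2 ^ N * s) 0).re ^ 2 with ha
  set b : ℕ → ℝ := fun N => (theta (2 ^ N * s) (1 / 2)).re ^ 2 with hb
  have hN : ∀ N : ℕ, 0 < 2 ^ N * s := fun N => by positivity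
  have hI : ∀ N, gaussInt (a N) (b N) =
      gaussInt ((theta s 0).re ^ 2) ((theta s (1 / 2)).re ^ 2) := by
    intro N
    induction N with
    | zero => simp [ha, hb]
    | succ N ih =>
      rw [← ih, ← gaussInt_theta_double (hN N)]
      simp only [ha, hb]
      rw [pow_succ' (2 : ℝ), mul_assoc]
  have h1 := (tendsto_theta_half (s := s) (y := 0) (by rw [abs_zero]; positivity)).comp
    (tendsto_pow_atTop_atTop_of_one_lt (one_lt_two (α := ℝ)))
  have h1' := (Complex.continuous_re.tendsto 1).comp h1
  simp only [Function.comp_def, mul_zero, Complex.ofReal_zero, zero_add, Complex.one_re] at h1'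
  -- `tendsto_theta_half` covers only `θ₄`; the limit of `θ₃(0)` follows from `θ₃(0) = θ₄(0;
  -- 2s)²/θ₄(0; s)`.
  have h2 : Tendsto (fun N : ℕ => (theta (2 ^ N * s) 0).re) atTop (𝓝 1) := by
    have h3 := (((tendsto_add_atTop_iff_nat 1).mpr h1').pow 2).div h1' one_ne_zero
    rw [one_pow, div_one] at h3
    refine h3.congr fun N => ?_
    have e1 := theta_zero_mul (hN N)
    rw [← ofReal_re_theta_zero (hN N), ← ofReal_re_theta_half (hN N),
      ← ofReal_re_theta_half (s := 2 * (2 ^ N * s)) (by linarith [hN N])] at e1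
    replace e1 : (theta (2 ^ N * s) 0).re * (theta (2 ^ N * s) (1 / 2)).re =
        (theta (2 * (2 ^ N * s)) (1 / 2)).re ^ 2 := by exact_mod_cast e1
    rw [Pi.div_apply, div_eq_iff (re_theta_half_pos (hN N)).ne', e1, pow_succ' (2 : ℝ), mul_assoc]
  have ha1 : Tendsto a atTop (𝓝 1) := by simpa using h2.pow 2
  have hb1 : Tendsto b atTop (𝓝 1) := by simpa only [one_pow] using h1'.pow 2
  have hpos : ∀ N, 0 < min (a N) (b N) := fun N => by
    have := re_theta_zero_pos (hN N)
    have := re_theta_half_pos (hN N)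
    simp only [ha, hb]
    positivity
  have hbd := fun N => gaussInt_bounds (hpos N) (min_le_left _ _) (min_le_right _ _)
    (le_max_left (a N) (b N)) (le_max_right (a N) (b N))
  simp only [hI] at hbd
  have hmin : Tendsto (fun N => Real.pi / 2 * (1 / min (a N) (b N))) atTop (𝓝 (Real.pi / 2)) := by
    simpa using ((ha1.min hb1).inv₀ (by simp)).const_mul (Real.pi / 2)
  have hmax : Tendsto (fun N => Real.pi / 2 * (1 / max (a N) (b N))) atTop (𝓝 (Real.pi / 2)) := by
    simpa using ((ha1.max hb1).inv₀ (by simp)).const_mul (Real.pi / 2)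
  exact le_antisymm (ge_of_tendsto' hmin fun N => (hbd N).2) (le_of_tendsto' hmax fun N => (hbd N).1)

/-- The complementary modulus attached to the lattice parameter `i s`. -/
def thetaModulus (s : ℝ) : ℝ := ((theta s (1 / 2)).re / (theta s 0).re) ^ 2

/-- Jacobi's quartic identity divided by `θ₃(0)⁴`: it identifies the modulus complementary to
`thetaModulus s`. -/
theorem sq_thetaModulus_add {s : ℝ} (hs : 0 < s) :
    thetaModulus s ^ 2 + (((theta (1 / s) (1 / 2)).re / √s / (theta s 0).re) ^ 2) ^ 2 = 1 := by
  have h := theta_quartic hs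
  have p0 := re_theta_zero_pos hs
  rw [← ofReal_re_theta_zero hs, ← ofReal_re_theta_half hs,
    ← ofReal_re_theta_half (s := 1 / s) (by positivity)] at h
  norm_cast at h
  have h4 : (theta s 0).re ^ 4 ≠ 0 := by positivity
  calc _ = ((theta s (1 / 2)).re ^ 4 + ((theta (1 / s) (1 / 2)).re / √s) ^ 4) /
        (theta s 0).re ^ 4 := by rw [thetaModulus]; ring
    _ = 1 := by rw [← h, div_self h4]

theorem ellipticK_sqrt_thetaModulus {s : ℝ} (hs : 0 < s) :
    ellipticK √(1 - thetaModulus s ^ 2) = (theta s 0).re ^ 2 * (Real.pi / 2) := by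
  have p0 := re_theta_zero_pos hs
  have h := sq_thetaModulus_add hs
  have h1 : 0 ≤ 1 - thetaModulus s ^ 2 := by rw [← h]; simp only [add_sub_cancel_left]; positivity
  have h2 : 0 ≤ thetaModulus s := sq_nonneg _
  rw [ellipticK_eq_gaussInt (by rw [Real.sq_sqrt h1]; nlinarith), Real.sq_sqrt h1, sub_sub_cancel,
    Real.sqrt_sq h2, ← gaussInt_theta hs]
  have := gaussInt_mul (c := (theta s 0).re ^ 2) (by positivity) 1 (thetaModulus s)
  rw [mul_one, thetaModulus, ← mul_pow, mul_div_cancel₀ _ p0.ne'] at this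
  rw [this, thetaModulus]
  field_simp

/-- The evaluation of Gauss's integral at parameter `1/s`, carried back by `θ₃(0; 1/s) = √s θ₃(0;
s)`; this produces the extra factor `s`. -/
theorem ellipticK_thetaModulus {s : ℝ} (hs : 0 < s) :
    ellipticK (thetaModulus s) = (theta s 0).re ^ 2 * (s * (Real.pi / 2)) := by
  have hs' : 0 < 1 / s := by positivity
  have p0 := re_theta_zero_pos hs
  have h := sq_thetaModulus_add hs
  set r' := ((theta (1 / s) (1 / 2)).re / √s / (theta s 0).re) ^ 2 with hr'
  have h2 : 0 ≤ r' := sq_nonneg _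
  rw [ellipticK_eq_gaussInt (by nlinarith), show 1 - thetaModulus s ^ 2 = r' ^ 2 by linarith,
    Real.sqrt_sq h2, ← gaussInt_theta hs']
  have hmod := theta_modular hs 0
  simp only [mul_zero, zero_div, ne_eq, OfNat.ofNat_ne_zero, not_false_eq_true, zero_pow,
    Complex.exp_zero, mul_one] at hmod
  rw [← ofReal_re_theta_zero hs, ← ofReal_re_theta_zero hs'] at hmod
  norm_cast at hmod
  have hsq : 0 < √s := Real.sqrt_pos.mpr hs
  have hss : √s ^ 2 = s := Real.sq_sqrt hs.le
  have h3 : (theta (1 / s) 0).re = √s * (theta s 0).re := by rw [hmod]; field_simp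
  have := gaussInt_mul (c := (√s * (theta s 0).re) ^ 2) (by positivity) 1 r'
  rw [mul_one, hr', ← mul_pow, show √s * (theta s 0).re *
    ((theta (1 / s) (1 / 2)).re / √s / (theta s 0).re) = (theta (1 / s) (1 / 2)).re by field_simp,
    ← hr'] at this
  rw [h3, this, mul_pow, hss]
  field_simp

/-- The theta quotient `θ₄(0)² / θ₃(0)²` inverts the ratio of complete elliptic integrals. -/
theorem thetaModulus_ratio {r : ℝ} (hr0 : 0 < r) (hr1 : r < 1) :
    thetaModulus (ellipticK r / ellipticK √(1 - r ^ 2)) = r := by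
  set s := ellipticK r / ellipticK √(1 - r ^ 2) with hsdef
  have hr2 : r ^ 2 < 1 := by nlinarith
  have hs : 0 < s := div_pos (ellipticK_pos hr2) (ellipticK_pos (by
    rw [Real.sq_sqrt (by linarith)]; nlinarith))
  have p0 := re_theta_zero_pos hs
  have hm0 : 0 < thetaModulus s := by
    have := re_theta_half_pos hs
    unfold thetaModulus; positivity
  have hm1 : thetaModulus s < 1 := by
    have h := sq_thetaModulus_add hs
    have := re_theta_half_pos (show 0 < 1 / s by positivity)
    have : 0 < (((theta (1 / s) (1 / 2)).re / √s / (theta s 0).re) ^ 2) ^ 2 := by positivity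
    nlinarith
  have hratio : ellipticK (thetaModulus s) / ellipticK √(1 - thetaModulus s ^ 2) = s := by
    rw [ellipticK_thetaModulus hs, ellipticK_sqrt_thetaModulus hs]
    field_simp
  -- Both moduli have the same ratio `s` of elliptic integrals, and that ratio is strictly
  -- increasing.
  rcases lt_trichotomy (thetaModulus s) r with h | h | h
  · have := ellipticK_ratio_strictMono hm0 h hr1
    rw [hratio] at this
    exact absurd this (lt_irrefl _)
  · exact h
  · have := ellipticK_ratio_strictMono hr0 h hm1
    rw [hratio] at this
    exact absurd this (lt_irrefl _)

/-! ### Tools from complex analysis -/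

/-- A holomorphic injective function on an open set has nonvanishing derivative. -/
theorem deriv_ne_zero_of_injOn {f : ℂ → ℂ} {U : Set ℂ} (hU : IsOpen U)
    (hf : DifferentiableOn ℂ f U) (hinj : InjOn f U) {a : ℂ} (ha : a ∈ U) : deriv f a ≠ 0 := by
  have han : AnalyticOnNhd ℂ f U := hf.analyticOnNhd hU
  set g := Function.invFunOn f U with hg
  have hgf : ∀ z ∈ U, g (f z) = z := fun z hz => hinj.leftInvOn_invFunOn hz
  have hopen : ∀ z ∈ U, 𝓝 (f z) ≤ map f (𝓝 z) := by
    intro z hz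
    refine ((han z hz).eventually_constant_or_nhds_le_map_nhds).resolve_left fun hc => ?_
    have h1 : ∀ᶠ w in 𝓝[≠] z, w ∈ U ∧ f w = f z :=
      nhdsWithin_le_nhds ((hU.eventually_mem hz).and hc)
    obtain ⟨w, ⟨hw, hw'⟩, hne⟩ := (h1.and self_mem_nhdsWithin).exists
    exact hne (hinj hw hz hw')
  have hcont : ∀ z ∈ U, ContinuousAt g (f z) := by
    intro z hz
    have h1 : map g (𝓝 (f z)) ≤ 𝓝 z := calc
      map g (𝓝 (f z)) ≤ map g (map f (𝓝 z)) := map_mono (hopen z hz)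
      _ = map (g ∘ f) (𝓝 z) := map_map
      _ = map id (𝓝 z) := map_congr (by
        filter_upwards [hU.mem_nhds hz] with w hw using hgf w hw)
      _ = 𝓝 z := map_id
    rw [ContinuousAt, hgf z hz]
    exact h1
  have hfg : ∀ z ∈ U, ∀ᶠ w in 𝓝 (f z), f (g w) = w := by
    intro z hz
    refine hopen z hz (mem_map.mpr ?_)
    filter_upwards [hU.mem_nhds hz] with w hw
    simp [hgf w hw]
  -- Otherwise the derivative vanishes near `a` and `f` is locally constant, against injectivity.
  have hder : ∀ᶠ z in 𝓝[≠] a, deriv f z ≠ 0 := by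
    refine ((han a ha).deriv.eventually_eq_zero_or_eventually_ne_zero).resolve_left fun h0 => ?_
    obtain ⟨ε, hε, hball⟩ := Metric.eventually_nhds_iff_ball.mp
      (h0.and (hU.eventually_mem ha))
    have hconst : ∀ w ∈ Metric.ball a ε, f w = f a := fun w hw =>
      (convex_ball a ε).is_const_of_fderivWithin_eq_zero (𝕜 := ℂ)
        (hf.mono fun v hv => (hball v hv).2) (fun v hv => by
          rw [fderivWithin_of_isOpen Metric.isOpen_ball hv]
          ext
          simpa using (hball v hv).1) hw (Metric.mem_ball_self hε)
    have h1 : ∀ᶠ w in 𝓝[≠] a, w ∈ Metric.ball a ε :=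
      nhdsWithin_le_nhds (Metric.ball_mem_nhds a hε)
    obtain ⟨w, hw, hne⟩ := (h1.and self_mem_nhdsWithin).exists
    exact hne (hinj (hball w hw).2 ha (hconst w hw))
  have hgd : ∀ᶠ w in 𝓝[≠] (f a), DifferentiableAt ℂ g w := by
    have h1 : ∀ᶠ z in 𝓝 a, z ∈ U ∧ (z ≠ a → deriv f z ≠ 0) :=
      (hU.eventually_mem ha).and (eventually_nhdsWithin_iff.mp hder)
    have h2 : ∀ᶠ w in 𝓝 (f a), ∃ z, (z ∈ U ∧ (z ≠ a → deriv f z ≠ 0)) ∧ f z = w :=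
      hopen a ha (mem_map.mpr <| by filter_upwards [h1] with z hz using ⟨z, hz, rfl⟩)
    rw [eventually_nhdsWithin_iff]
    filter_upwards [h2] with w hw hne
    obtain ⟨z, ⟨hz, hz'⟩, rfl⟩ := hw
    have hza : z ≠ a := fun h => hne (by rw [h]; rfl)
    have hd : HasDerivAt f (deriv f z) (g (f z)) := by
      rw [hgf z hz]; exact (han z hz).differentiableAt.hasDerivAt
    exact (HasDerivAt.of_local_left_inverse (hcont z hz) hd (hz' hza) (hfg z hz)).differentiableAt
  -- The inverse is continuous at `f a` and holomorphic around it, so the singularity is removable;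
  -- the chain rule then excludes a zero derivative.
  have hga : DifferentiableAt ℂ g (f a) :=
    (Complex.analyticAt_of_differentiable_on_punctured_nhds_of_continuousAt hgd
      (hcont a ha)).differentiableAt
  intro h0
  have hcomp : HasDerivAt (g ∘ f) (deriv g (f a) * deriv f a) a :=
    hga.hasDerivAt.comp a (han a ha).differentiableAt.hasDerivAt
  have hid : HasDerivAt (g ∘ f) 1 a := (hasDerivAt_id a).congr_of_eventuallyEq (by
    filter_upwards [hU.mem_nhds ha] with w hw using hgf w hw)
  have := hcomp.unique hid
  simp [h0] at this

/-- Rigidity in the Schwarz lemma, with a proper map to the unit disc in place of a Riemann map. -/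
theorem eqOn_of_norm_le_one_of_proper {E : Set ℂ} (hEo : IsOpen E) (hEb : Bornology.IsBounded E)
    (hEp : IsPreconnected E) {B p : ℂ → ℂ} (hB : DifferentiableOn ℂ B E)
    (hp : DifferentiableOn ℂ p E) (hB1 : ∀ v ∈ E, ‖B v‖ < 1)
    (hproper : ∀ t < 1, ∃ K, IsClosed K ∧ K ⊆ E ∧ ∀ v ∈ E, ‖B v‖ < t → v ∈ K)
    {a b : ℂ} (ha : a ∈ E) (hb : b ∈ E) (hab : b ≠ a) (hBa : B a = 0) (hBd : deriv B a ≠ 0)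
    (hB0 : ∀ v ∈ E, B v = 0 → v = a) (hp1 : ∀ v ∈ E, ‖p v‖ ≤ 1) (hpa : p a = 0)
    (hpb : p b = B b) : EqOn p B E := by
  have hEa := hEo.mem_nhds ha
  have hBs := (Complex.differentiableOn_dslope hEa).mpr hB
  have hps := (Complex.differentiableOn_dslope hEa).mpr hp
  have hne : ∀ v ∈ E, dslope B a v ≠ 0 := by
    intro v hv
    by_cases h : v = a
    · rw [h, dslope_same]; exact hBd
    · rw [dslope_of_ne _ h, slope_def_field, hBa, sub_zero]
      exact div_ne_zero (fun h' => h (hB0 v hv h')) (sub_ne_zero.mpr h)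
  -- This is `p/B` with the common zero at `a` divided out, hence holomorphic on all of `E`.
  set W : ℂ → ℂ := fun v => dslope p a v / dslope B a v with hW
  have hWd : DifferentiableOn ℂ W E := hps.div hBs hne
  have hWv : ∀ v ∈ E, v ≠ a → W v = p v / B v := by
    intro v hv h
    simp only [hW]
    rw [dslope_of_ne _ h, dslope_of_ne _ h, slope_def_field, slope_def_field, hBa, hpa, sub_zero,
      sub_zero, div_div_div_cancel_right₀ (sub_ne_zero.mpr h)]
  have hWle : ∀ u ∈ E, ‖W u‖ ≤ 1 := by
    intro u hu
    -- Maximum principle on `{‖B‖ < t}`: properness keeps its closure inside `E`, and on its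
    -- frontier `‖B‖ ≥ t`. Then `t → 1`.
    have hbound : ∀ t : ℝ, ‖B u‖ < t → t < 1 → ‖W u‖ ≤ 1 / t := by
      intro t ht ht1
      have ht0 : 0 < t := (norm_nonneg _).trans_lt ht
      obtain ⟨K, hK, hKE, hKt⟩ := hproper t ht1
      set U : Set ℂ := E ∩ (fun v => ‖B v‖) ⁻¹' Iio t with hUdef
      have hUo : IsOpen U := hB.continuousOn.norm.isOpen_inter_preimage hEo isOpen_Iio
      have hcl : closure U ⊆ E := (closure_minimal (fun v hv => hKt v hv.1 hv.2) hK).trans hKE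
      refine Complex.norm_le_of_forall_mem_frontier_norm_le (U := U) (f := W)
        (hEb.subset inter_subset_left) ⟨hWd.mono inter_subset_left, hWd.continuousOn.mono hcl⟩
        (fun v hv => ?_) (subset_closure ⟨hu, ht⟩)
      have hvE : v ∈ E := hcl hv.1
      have hvt : t ≤ ‖B v‖ := by
        by_contra h
        exact hv.2 (by rw [hUo.interior_eq]; exact ⟨hvE, not_le.mp h⟩)
      have hva : v ≠ a := by
        rintro rfl
        rw [hBa, norm_zero] at hvt
        linarith
      rw [hWv v hvE hva, norm_div]
      exact div_le_div₀ zero_le_one (hp1 v hvE) ht0 hvt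
    have hlim : Tendsto (fun t : ℝ => 1 / t) (𝓝[<] 1) (𝓝 (1 / 1)) :=
      ((continuousAt_const.div continuousAt_id one_ne_zero).tendsto).mono_left nhdsWithin_le_nhds
    rw [one_div_one] at hlim
    refine ge_of_tendsto hlim ?_
    filter_upwards [Ioo_mem_nhdsLT (hB1 u hu)] with t ht using hbound t ht.1 ht.2
  have hBb : B b ≠ 0 := fun h => hab (hB0 b hb h)
  have hWb : W b = 1 := by rw [hWv b hb hab, hpb, div_self hBb]
  have hmax : IsMaxOn (norm ∘ W) E b := fun v hv => by
    simp only [mem_ofPred_eq, Function.comp_apply, hWb, norm_one]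
    exact hWle v hv
  have hconst := Complex.eqOn_of_isPreconnected_of_isMaxOn_norm hEp hEo hWd hb hmax
  intro v hv
  by_cases h : v = a
  · rw [h, hpa, hBa]
  · have h1 := hconst hv
    rw [Function.const_apply, hWb, hWv v hv h] at h1
    have hBv : B v ≠ 0 := fun h' => h (hB0 v hv h')
    rwa [div_eq_one_iff_eq hBv] at h1

/-! ### Functions of the cosine -/

theorem cos_arccosC (u : ℂ) : Complex.cos (arccosC u) = u :=
  Function.surjInv_eq Complex.cos_surjective u

theorem comp_arccosC_cos {f : ℂ → ℂ} (heven : ∀ z, f (-z) = f z)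
    (hper : Function.Periodic f (2 * Real.pi)) (z : ℂ) :
    f (arccosC (Complex.cos z)) = f z := by
  obtain ⟨n, hn⟩ := Complex.cos_eq_cos_iff.mp (cos_arccosC (Complex.cos z))
  have h := fun w => hper.int_mul n w
  rcases hn with hn | hn
  · have h1 := h (arccosC (Complex.cos z))
    rw [← h1]
    congr 1
    linear_combination -hn
  · have h1 := h (-arccosC (Complex.cos z))
    rw [← heven, ← h1]
    congr 1
    linear_combination -hn

theorem nhds_cos_le_map (z : ℂ) : 𝓝 (Complex.cos z) ≤ map Complex.cos (𝓝 z) := by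
  refine ((Complex.differentiable_cos.analyticAt z).eventually_constant_or_nhds_le_map_nhds
    ).resolve_left fun hc => ?_
  have h1 : EqOn Complex.cos (fun _ => Complex.cos z) univ :=
    AnalyticOnNhd.eqOn_of_preconnected_of_eventuallyEq
      (fun w _ => Complex.differentiable_cos.analyticAt w) (fun w _ => analyticAt_const)
      isPreconnected_univ (mem_univ z) hc
  have h2 := h1 (mem_univ 0)
  have h3 := h1 (mem_univ (Real.pi : ℂ))
  rw [← h2, Complex.cos_pi, Complex.cos_zero] at h3
  norm_num at h3

/-- An even `2π`-periodic entire function is an entire function of the cosine. -/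
theorem differentiable_comp_arccosC {f : ℂ → ℂ} (hf : Differentiable ℂ f)
    (heven : ∀ z, f (-z) = f z) (hper : Function.Periodic f (2 * Real.pi)) :
    Differentiable ℂ fun u => f (arccosC u) := by
  set g : ℂ → ℂ := fun u => f (arccosC u) with hg
  have hgcos : ∀ z, g (Complex.cos z) = f z := comp_arccosC_cos heven hper
  have hcont : ∀ u, ContinuousAt g u := by
    intro u
    obtain ⟨z, rfl⟩ := Complex.cos_surjective u
    rw [ContinuousAt, hgcos]
    calc map g (𝓝 (Complex.cos z)) ≤ map g (map Complex.cos (𝓝 z)) := map_mono (nhds_cos_le_map z)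
      _ = map f (𝓝 z) := by rw [map_map]; congr 1; exact funext hgcos
      _ ≤ 𝓝 (f z) := hf.continuous.tendsto z
  have hreg : ∀ u : ℂ, u ^ 2 ≠ 1 → DifferentiableAt ℂ g u := by
    intro u hu
    obtain ⟨z, rfl⟩ := Complex.cos_surjective u
    have hsin : -Complex.sin z ≠ 0 := by
      intro h
      apply hu
      have := Complex.sin_sq_add_cos_sq z
      rw [neg_eq_zero.mp h] at this
      simpa using this
    have hs : HasStrictDerivAt Complex.cos (-Complex.sin z) z := Complex.hasStrictDerivAt_cos z
    set h := hs.localInverse _ _ _ hsin with hh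
    have hh' : HasStrictDerivAt h (-Complex.sin z)⁻¹ (Complex.cos z) := hs.to_localInverse hsin
    have hr : ∀ᶠ w in 𝓝 (Complex.cos z), Complex.cos (h w) = w := by
      have := (hs.hasStrictFDerivAt_equiv hsin).eventually_right_inverse
      exact this
    have hd : DifferentiableAt ℂ (fun w => f (h w)) (Complex.cos z) :=
      (hf _).comp _ hh'.hasDerivAt.differentiableAt
    refine hd.congr_of_eventuallyEq ?_
    filter_upwards [hr] with w hw
    rw [← hgcos, hw]
  intro u
  -- The critical values `±1` of the cosine are isolated, and continuity there makes them removable.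
  refine (Complex.analyticAt_of_differentiable_on_punctured_nhds_of_continuousAt ?_
    (hcont u)).differentiableAt
  have h1 : ∀ᶠ w in 𝓝[≠] u, w ^ 2 - 1 ≠ 0 := by
    have han : AnalyticAt ℂ (fun w : ℂ => w ^ 2 - 1) u := by fun_prop
    refine han.eventually_eq_zero_or_eventually_ne_zero.resolve_left fun h0 => ?_
    have h1 : EqOn (fun w : ℂ => w ^ 2 - 1) (fun _ => 0) univ :=
      AnalyticOnNhd.eqOn_of_preconnected_of_eventuallyEq
        (fun w _ => (by fun_prop : AnalyticAt ℂ (fun w : ℂ => w ^ 2 - 1) w))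
        (fun w _ => analyticAt_const) isPreconnected_univ (mem_univ u) h0
    have := h1 (mem_univ 0)
    norm_num at this
  filter_upwards [h1] with w hw using hreg w (fun h => hw (by rw [h, sub_self]))

/-! ### Bernstein ellipses and the cosine -/

/-- The defect of the ellipse equation is `sinh² (Im z) - sinh² η` times a positive factor, which
settles open and closed ellipses at once. The semi-axes `cosh η`, `sinh η` belong to the parameter
`exp η`. -/
theorem cos_ellipse_lt_and_le_iff {η : ℝ} (hη : 0 < η) (z : ℂ) :
    ((Complex.cos z).re ^ 2 / Real.cosh η ^ 2 + (Complex.cos z).im ^ 2 / Real.sinh η ^ 2 < 1 ↔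
      |z.im| < η) ∧
    ((Complex.cos z).re ^ 2 / Real.cosh η ^ 2 + (Complex.cos z).im ^ 2 / Real.sinh η ^ 2 ≤ 1 ↔
      |z.im| ≤ η) := by
  have hre : (Complex.cos z).re = Real.cos z.re * Real.cosh z.im := by
    rw [Complex.cos_eq]; simp [← Complex.ofReal_cos, ← Complex.ofReal_sin, ← Complex.ofReal_cosh,
      ← Complex.ofReal_sinh]
  have him : (Complex.cos z).im = -(Real.sin z.re * Real.sinh z.im) := by
    rw [Complex.cos_eq]; simp [← Complex.ofReal_cos, ← Complex.ofReal_sin, ← Complex.ofReal_cosh,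
      ← Complex.ofReal_sinh]
  have hS : 0 < Real.sinh η ^ 2 := by have := Real.sinh_pos_iff.mpr hη; positivity
  have hC : 0 < Real.cosh η ^ 2 := by positivity
  have h1 := Real.sin_sq_add_cos_sq z.re
  have h2 := Real.cosh_sq z.im
  have h3 := Real.cosh_sq η
  set S := Real.sinh η ^ 2
  set C := Real.cosh η ^ 2
  set s := Real.sinh z.im ^ 2 with hs
  set x := Real.sin z.re ^ 2 with hx
  have hx0 : 0 ≤ x := sq_nonneg _
  have hx1 : x ≤ 1 := Real.sin_sq_le_one _
  have key : (Complex.cos z).re ^ 2 / C + (Complex.cos z).im ^ 2 / S - 1 =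
      (s - S) * ((1 - x) / C + x / S) := by
    rw [hre, him, mul_pow, neg_sq, mul_pow, h2, ← hs, ← hx, show Real.cos z.re ^ 2 = 1 - x by
      linarith]
    field_simp
    rw [h3]
    ring
  have hfac : 0 < (1 - x) / C + x / S := by
    rcases hx1.lt_or_eq with h | h
    · have : 0 < (1 - x) / C := div_pos (by linarith) hC
      have : 0 ≤ x / S := by positivity
      linarith
    · rw [h]; simp; positivity
  have habs : |Real.sinh z.im| = Real.sinh |z.im| := Real.abs_sinh z.im
  have hηs : |Real.sinh η| = Real.sinh η := abs_of_pos (Real.sinh_pos_iff.mpr hη)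
  have hlt : s < S ↔ |z.im| < η := by rw [sq_lt_sq, habs, hηs, Real.sinh_lt_sinh]
  have hle : s ≤ S ↔ |z.im| ≤ η := by rw [sq_le_sq, habs, hηs, Real.sinh_le_sinh]
  constructor
  · rw [← hlt, ← sub_neg, key, ← sub_neg (a := s)]
    exact ⟨fun h => lt_of_not_ge fun h' => (mul_nonneg h' hfac.le).not_gt h,
      fun h => mul_neg_of_neg_of_pos h hfac⟩
  · rw [← hle, ← sub_nonpos, key, ← sub_nonpos (a := s)]
    exact ⟨fun h => le_of_not_gt fun h' => (mul_pos h' hfac).not_ge h,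
      fun h => mul_nonpos_of_nonpos_of_nonneg h hfac.le⟩

theorem mem_bernsteinEllipse_exp {η : ℝ} {u : ℂ} :
    u ∈ bernsteinEllipse (Real.exp η : ℝ) ↔
      u.re ^ 2 / Real.cosh η ^ 2 + u.im ^ 2 / Real.sinh η ^ 2 < 1 := by
  unfold bernsteinEllipse
  rw [if_neg (EReal.coe_ne_top _), mem_ofPred_eq, EReal.toReal_coe, Real.cosh_eq, Real.sinh_eq,
    Real.exp_neg]

theorem cos_mem_bernsteinEllipse {η : ℝ} (hη : 0 < η) {z : ℂ} :
    Complex.cos z ∈ bernsteinEllipse (Real.exp η : ℝ) ↔ |z.im| < η := by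
  rw [mem_bernsteinEllipse_exp, (cos_ellipse_lt_and_le_iff hη z).1]

/-- The closed Bernstein ellipse with parameter `exp η`. -/
def closedEllipse (η : ℝ) : Set ℂ :=
  {u | u.re ^ 2 / Real.cosh η ^ 2 + u.im ^ 2 / Real.sinh η ^ 2 ≤ 1}

theorem isClosed_closedEllipse (η : ℝ) : IsClosed (closedEllipse η) :=
  isClosed_le (by fun_prop) continuous_const

theorem cos_mem_closedEllipse {η : ℝ} (hη : 0 < η) {z : ℂ} :
    Complex.cos z ∈ closedEllipse η ↔ |z.im| ≤ η :=
  (cos_ellipse_lt_and_le_iff hη z).2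

theorem bernsteinEllipse_subset_closedEllipse (η : ℝ) :
    bernsteinEllipse (Real.exp η : ℝ) ⊆ closedEllipse η := fun _ hu =>
  (mem_bernsteinEllipse_exp.mp hu).le

theorem isBounded_bernsteinEllipse {η : ℝ} (hη : 0 < η) :
    Bornology.IsBounded (bernsteinEllipse (Real.exp η : ℝ)) := by
  rw [isBounded_iff_forall_norm_le]
  refine ⟨Real.cosh η + Real.sinh η, fun u hu => ?_⟩
  rw [mem_bernsteinEllipse_exp] at hu
  have hS : 0 < Real.sinh η := Real.sinh_pos_iff.mpr hη
  have hC : 0 < Real.cosh η := Real.cosh_pos η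
  have h1 : 0 ≤ u.re ^ 2 / Real.cosh η ^ 2 := by positivity
  have h2 : 0 ≤ u.im ^ 2 / Real.sinh η ^ 2 := by positivity
  have h3 : u.re ^ 2 / Real.cosh η ^ 2 ≤ 1 := by linarith
  have h4 : u.im ^ 2 / Real.sinh η ^ 2 ≤ 1 := by linarith
  rw [div_le_one (by positivity)] at h3 h4
  exact (Complex.norm_le_abs_re_add_abs_im u).trans
    (add_le_add (abs_le_of_sq_le_sq h3 hC.le) (abs_le_of_sq_le_sq h4 hS.le))

section

open Complex ComplexConjugate

/-! ### The extremal map -/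

/-- `θ₃(arccos u / 2)`, as an entire function of `u`. -/
def thetaNum (s : ℝ) (u : ℂ) : ℂ := theta s (arccosC u / (2 * Real.pi))

/-- `θ₄(arccos u / 2)`, as an entire function of `u`. -/
def thetaDen (s : ℝ) (u : ℂ) : ℂ := theta s (arccosC u / (2 * Real.pi) + 1 / 2)

/-- The conformal map of the ellipse with parameter `exp (π s)` onto the right half-plane. -/
def thetaQuo (s : ℝ) (u : ℂ) : ℂ :=
  theta s (1 / 2) / theta s 0 * (thetaNum s u / thetaDen s u)

theorem ofReal_two_pi_ne_zero : (2 * Real.pi : ℂ) ≠ 0 := by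
  exact_mod_cast (by positivity : (2 * Real.pi : ℝ) ≠ 0)

theorem differentiable_thetaNum_and_cos {s : ℝ} (hs : 0 < s) :
    Differentiable ℂ (thetaNum s) ∧
      ∀ z, thetaNum s (Complex.cos z) = theta s (z / (2 * Real.pi)) := by
  have hper : Function.Periodic (fun z => theta s (z / (2 * Real.pi))) (2 * Real.pi) := fun z => by
    simp only [add_div, div_self ofReal_two_pi_ne_zero, theta_add_one]
  have heven : ∀ z : ℂ, theta s (-z / (2 * Real.pi)) = theta s (z / (2 * Real.pi)) := fun z => by
    rw [neg_div, theta_neg]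
  refine ⟨differentiable_comp_arccosC (f := fun z => theta s (z / (2 * Real.pi))) ?_ heven hper,
    comp_arccosC_cos (f := fun z => theta s (z / (2 * Real.pi))) heven hper⟩
  exact (differentiable_theta hs).comp (differentiable_id.div_const _)

theorem differentiable_thetaDen_and_cos {s : ℝ} (hs : 0 < s) :
    Differentiable ℂ (thetaDen s) ∧
      ∀ z, thetaDen s (Complex.cos z) = theta s (z / (2 * Real.pi) + 1 / 2) := by
  have hper : Function.Periodic (fun z => theta s (z / (2 * Real.pi) + 1 / 2)) (2 * Real.pi) :=
    fun z => by
      simp only [add_div, div_self ofReal_two_pi_ne_zero]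
      rw [add_right_comm, theta_add_one]
  have heven : ∀ z : ℂ, theta s (-z / (2 * Real.pi) + 1 / 2) =
      theta s (z / (2 * Real.pi) + 1 / 2) := fun z => by
    rw [neg_div, theta_half_sub]
  refine ⟨differentiable_comp_arccosC (f := fun z => theta s (z / (2 * Real.pi) + 1 / 2)) ?_ heven
    hper, comp_arccosC_cos (f := fun z => theta s (z / (2 * Real.pi) + 1 / 2)) heven hper⟩
  exact (differentiable_theta hs).comp ((differentiable_id.div_const _).add_const _)

theorem differentiable_thetaNum {s : ℝ} (hs : 0 < s) : Differentiable ℂ (thetaNum s) :=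
  (differentiable_thetaNum_and_cos hs).1

theorem differentiable_thetaDen {s : ℝ} (hs : 0 < s) : Differentiable ℂ (thetaDen s) :=
  (differentiable_thetaDen_and_cos hs).1

theorem thetaNum_cos {s : ℝ} (hs : 0 < s) (z : ℂ) :
    thetaNum s (Complex.cos z) = theta s (z / (2 * Real.pi)) :=
  (differentiable_thetaNum_and_cos hs).2 z

theorem thetaDen_cos {s : ℝ} (hs : 0 < s) (z : ℂ) :
    thetaDen s (Complex.cos z) = theta s (z / (2 * Real.pi) + 1 / 2) :=
  (differentiable_thetaDen_and_cos hs).2 z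

theorem abs_im_div_two_pi (z : ℂ) :
    |(z / (2 * Real.pi)).im| = |z.im| / (2 * Real.pi) := by
  rw [show (2 * Real.pi : ℂ) = ((2 * Real.pi : ℝ) : ℂ) by push_cast; rfl, Complex.div_ofReal_im,
    abs_div, abs_of_pos (a := 2 * Real.pi) (by positivity)]

theorem abs_im_div_two_pi_lt {s : ℝ} {z : ℂ} (hz : |z.im| < Real.pi * s) :
    |(z / (2 * Real.pi)).im| < s / 2 := by
  rw [abs_im_div_two_pi, div_lt_iff₀ (by positivity)]
  linarith

theorem pi_mul_pos {s : ℝ} (hs : 0 < s) : 0 < Real.pi * s := mul_pos Real.pi_pos hs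

theorem re_thetaNum_mul_conj_pos {s : ℝ} (hs : 0 < s) {u : ℂ}
    (hu : u ∈ bernsteinEllipse (Real.exp (Real.pi * s) : ℝ)) :
    0 < (thetaNum s u * conj (thetaDen s u)).re := by
  obtain ⟨z, rfl⟩ := Complex.cos_surjective u
  rw [cos_mem_bernsteinEllipse (pi_mul_pos hs)] at hu
  rw [thetaNum_cos hs, thetaDen_cos hs]
  exact re_theta_mul_conj_pos (abs_im_div_two_pi_lt hu)

theorem re_thetaNum_mul_conj_eq_zero {s : ℝ} (hs : 0 < s) {u : ℂ}
    (hu : u ∈ closedEllipse (Real.pi * s))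
    (hu' : u ∉ bernsteinEllipse (Real.exp (Real.pi * s) : ℝ)) :
    (thetaNum s u * conj (thetaDen s u)).re = 0 := by
  obtain ⟨z, rfl⟩ := Complex.cos_surjective u
  rw [cos_mem_bernsteinEllipse (pi_mul_pos hs)] at hu'
  rw [cos_mem_closedEllipse (pi_mul_pos hs)] at hu
  rw [thetaNum_cos hs, thetaDen_cos hs]
  refine re_theta_mul_conj_eq_zero hs ?_
  rw [abs_im_div_two_pi, le_antisymm hu (not_lt.mp hu')]
  field_simp

theorem normSq_thetaNum_add_pos {s : ℝ} (hs : 0 < s) (u : ℂ) :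
    0 < normSq (thetaNum s u) + normSq (thetaDen s u) := by
  obtain ⟨z, rfl⟩ := Complex.cos_surjective u
  rw [thetaNum_cos hs, thetaDen_cos hs]
  exact normSq_theta_add_pos hs _

theorem thetaDen_ne_zero {s : ℝ} (hs : 0 < s) {u : ℂ}
    (hu : u ∈ bernsteinEllipse (Real.exp (Real.pi * s) : ℝ)) : thetaDen s u ≠ 0 := fun h => by
  have := re_thetaNum_mul_conj_pos hs hu
  simp [h] at this

/-- The real constant `θ₄(0) / θ₃(0)`. -/
def thetaConst (s : ℝ) : ℝ := (theta s (1 / 2)).re / (theta s 0).re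

theorem thetaConst_pos {s : ℝ} (hs : 0 < s) : 0 < thetaConst s :=
  div_pos (re_theta_half_pos hs) (re_theta_zero_pos hs)

theorem thetaQuo_eq {s : ℝ} (hs : 0 < s) (u : ℂ) :
    thetaQuo s u = thetaConst s * thetaNum s u / thetaDen s u := by
  rw [thetaQuo, thetaConst, ← mul_div_assoc]
  push_cast
  rw [ofReal_re_theta_half hs, ofReal_re_theta_zero hs]

theorem re_thetaQuo_pos {s : ℝ} (hs : 0 < s) {u : ℂ}
    (hu : u ∈ bernsteinEllipse (Real.exp (Real.pi * s) : ℝ)) : 0 < (thetaQuo s u).re := by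
  have hd := thetaDen_ne_zero hs hu
  have h : thetaQuo s u = ((thetaConst s / normSq (thetaDen s u) : ℝ) : ℂ) *
      (thetaNum s u * conj (thetaDen s u)) := by
    rw [thetaQuo_eq hs, div_eq_mul_inv, Complex.inv_def]
    push_cast
    ring
  rw [h, Complex.re_ofReal_mul]
  exact mul_pos (div_pos (thetaConst_pos hs) (Complex.normSq_pos.mpr hd))
    (re_thetaNum_mul_conj_pos hs hu)

theorem differentiableOn_thetaQuo {s : ℝ} (hs : 0 < s) :
    DifferentiableOn ℂ (thetaQuo s) (bernsteinEllipse (Real.exp (Real.pi * s) : ℝ)) :=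
  ((differentiable_thetaNum hs).differentiableOn.div (differentiable_thetaDen hs).differentiableOn
    fun _ hu => thetaDen_ne_zero hs hu).const_mul _

theorem injOn_thetaQuo {s : ℝ} (hs : 0 < s) :
    InjOn (thetaQuo s) (bernsteinEllipse (Real.exp (Real.pi * s) : ℝ)) := by
  intro u hu v hv h
  have hdu := thetaDen_ne_zero hs hu
  have hdv := thetaDen_ne_zero hs hv
  have hc : (thetaConst s : ℂ) ≠ 0 := by exact_mod_cast (thetaConst_pos hs).ne'
  rw [thetaQuo_eq hs, thetaQuo_eq hs, div_eq_div_iff hdu hdv] at h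
  have h' : thetaNum s u * thetaDen s v = thetaNum s v * thetaDen s u :=
    mul_left_cancel₀ hc (by linear_combination h)
  obtain ⟨z, rfl⟩ := Complex.cos_surjective u
  obtain ⟨w, rfl⟩ := Complex.cos_surjective v
  rw [cos_mem_bernsteinEllipse (pi_mul_pos hs)] at hu hv
  rw [thetaNum_cos hs, thetaNum_cos hs, thetaDen_cos hs, thetaDen_cos hs] at h'
  obtain ⟨n, hn⟩ := theta_cross_eq_imp (abs_im_div_two_pi_lt hu) (abs_im_div_two_pi_lt hv) h'
  have hpi := ofReal_two_pi_ne_zero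
  rw [eq_comm, Complex.cos_eq_cos_iff]
  refine ⟨n, hn.imp (fun h => ?_) (fun h => ?_)⟩
  · field_simp at h
    linear_combination h
  · field_simp at h
    linear_combination h

theorem thetaQuo_one {s : ℝ} (hs : 0 < s) : thetaQuo s 1 = 1 := by
  have hN := thetaNum_cos hs 0
  have hD := thetaDen_cos hs 0
  have hc : (thetaConst s : ℂ) ≠ 0 := by exact_mod_cast (thetaConst_pos hs).ne'
  rw [Complex.cos_zero, zero_div] at hN hD
  rw [zero_add] at hD
  rw [thetaConst] at hc
  push_cast at hc
  rw [ofReal_re_theta_half hs, ofReal_re_theta_zero hs] at hc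
  rw [thetaQuo, hN, hD, ← inv_div (theta s (1 / 2)), mul_inv_cancel₀ hc]

theorem thetaQuo_neg_one {s : ℝ} (hs : 0 < s) : thetaQuo s (-1) = thetaModulus s := by
  have e : (Real.pi : ℂ) / (2 * Real.pi) = 1 / 2 := by
    have := ofReal_two_pi_ne_zero
    field_simp
  rw [thetaQuo, ← Complex.cos_pi, thetaNum_cos hs, thetaDen_cos hs, e,
    show (1 / 2 + 1 / 2 : ℂ) = 0 + 1 by norm_num, theta_add_one, thetaModulus]
  push_cast
  rw [ofReal_re_theta_half hs, ofReal_re_theta_zero hs]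
  ring

theorem thetaQuo_ofReal_im {s : ℝ} (hs : 0 < s) {x : ℝ} (hx : x ∈ Icc (-1 : ℝ) 1) :
    (thetaQuo s x).im = 0 := by
  obtain ⟨t, rfl⟩ : ∃ t : ℝ, Real.cos t = x := ⟨Real.arccos x, Real.cos_arccos hx.1 hx.2⟩
  rw [← Complex.conj_eq_iff_im, thetaQuo_eq hs, Complex.ofReal_cos, thetaNum_cos hs,
    thetaDen_cos hs, map_div₀, map_mul, Complex.conj_ofReal, conj_theta, conj_theta, map_add,
    conj_half, show (t / (2 * Real.pi) : ℂ) = ((t / (2 * Real.pi) : ℝ) : ℂ) by push_cast; rfl,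
    Complex.conj_ofReal]

theorem one_lt_exp_pi_mul {s : ℝ} (hs : 0 < s) :
    (1 : EReal) < (Real.exp (Real.pi * s) : ℝ) := by
  exact_mod_cast Real.one_lt_exp_iff.mpr (pi_mul_pos hs)

theorem one_mem_ellipse {s : ℝ} (hs : 0 < s) :
    (1 : ℂ) ∈ bernsteinEllipse (Real.exp (Real.pi * s) : ℝ) := by
  simpa using Icc_mem_bernsteinEllipse (one_lt_exp_pi_mul hs) (x := 1) (by norm_num)

theorem neg_one_mem_ellipse {s : ℝ} (hs : 0 < s) :
    (-1 : ℂ) ∈ bernsteinEllipse (Real.exp (Real.pi * s) : ℝ) := by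
  simpa using Icc_mem_bernsteinEllipse (one_lt_exp_pi_mul hs) (x := -1) (by norm_num)

/-! ### Cayley transform, Schwarz rigidity and the boundary pole -/

/-- The Cayley transform of the right half-plane onto the unit disc. -/
def cayley (w : ℂ) : ℂ := (w - 1) / (w + 1)

theorem add_one_ne_zero_of_re_nonneg {w : ℂ} (hw : 0 ≤ w.re) : w + 1 ≠ 0 := fun h => by
  have := congrArg Complex.re h
  simp at this
  linarith

theorem normSq_add_sub_normSq_sub (a b : ℂ) :
    normSq (a + b) - normSq (a - b) = 4 * (a * conj b).re := by
  simp [normSq_apply]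
  ring

theorem norm_sub_le_norm_add_iff (a b : ℂ) : ‖a - b‖ ≤ ‖a + b‖ ↔ 0 ≤ (a * conj b).re := by
  have h := normSq_add_sub_normSq_sub a b
  rw [← sq_le_sq₀ (norm_nonneg _) (norm_nonneg _), ← Complex.normSq_eq_norm_sq,
    ← Complex.normSq_eq_norm_sq]
  constructor <;> intro <;> linarith

theorem norm_cayley_le_one {w : ℂ} (hw : 0 ≤ w.re) : ‖cayley w‖ ≤ 1 := by
  rw [cayley, norm_div, div_le_one (norm_pos_iff.mpr (add_one_ne_zero_of_re_nonneg hw)),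
    norm_sub_le_norm_add_iff]
  simpa using hw

theorem norm_cayley_lt_one {w : ℂ} (hw : 0 < w.re) : ‖cayley w‖ < 1 := by
  rw [cayley, norm_div, div_lt_one (norm_pos_iff.mpr (add_one_ne_zero_of_re_nonneg hw.le)),
    ← not_le, norm_sub_rev, show ‖w + 1‖ = ‖1 - -w‖ by congr 1; ring,
    show ‖1 - w‖ = ‖1 + -w‖ by congr 1, norm_sub_le_norm_add_iff]
  simpa using hw

theorem cayley_injOn : InjOn cayley {w | w + 1 ≠ 0} := by
  intro w hw v hv h
  rw [cayley, cayley, div_eq_div_iff hw hv] at h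
  linear_combination h / 2

theorem differentiableOn_cayley_comp {f : ℂ → ℂ} {E : Set ℂ} (hf : DifferentiableOn ℂ f E)
    (hre : ∀ u ∈ E, 0 ≤ (f u).re) : DifferentiableOn ℂ (fun u => cayley (f u)) E :=
  (hf.sub_const 1).div (hf.add_const 1) fun u hu => add_one_ne_zero_of_re_nonneg (hre u hu)

theorem cayley_thetaQuo {s : ℝ} (hs : 0 < s) {u : ℂ}
    (hu : u ∈ bernsteinEllipse (Real.exp (Real.pi * s) : ℝ)) :
    cayley (thetaQuo s u) = (thetaConst s * thetaNum s u - thetaDen s u) /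
      (thetaConst s * thetaNum s u + thetaDen s u) := by
  have hd := thetaDen_ne_zero hs hu
  rw [cayley, thetaQuo_eq hs, div_sub_one hd, div_add_one hd, div_div_div_cancel_right₀ hd]

/-- With denominators cleared, the sublevel condition involves entire functions only and is closed.
At a boundary point of the ellipse `Re (N conj D) = 0` makes `|cN - D|` and `|cN + D|` equal; for `t
< 1` both vanish, so `N = D = 0`, which is impossible. -/
theorem cayley_thetaQuo_proper {s : ℝ} (hs : 0 < s) {t : ℝ} (ht : t < 1) :
    ∃ K, IsClosed K ∧ K ⊆ bernsteinEllipse (Real.exp (Real.pi * s) : ℝ) ∧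
      ∀ v ∈ bernsteinEllipse (Real.exp (Real.pi * s) : ℝ), ‖cayley (thetaQuo s v)‖ < t → v ∈ K := by
  have hN := (differentiable_thetaNum hs).continuous
  have hD := (differentiable_thetaDen hs).continuous
  have hc := thetaConst_pos hs
  refine ⟨closedEllipse (Real.pi * s) ∩ {u | ‖thetaConst s * thetaNum s u - thetaDen s u‖ ≤
      t * ‖thetaConst s * thetaNum s u + thetaDen s u‖},
    (isClosed_closedEllipse _).inter (isClosed_le (by fun_prop) (by fun_prop)), ?_, ?_⟩
  · rintro u ⟨hu, hut⟩
    rw [mem_ofPred_eq] at hut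
    by_contra hu'
    have h0 := re_thetaNum_mul_conj_eq_zero hs hu hu'
    have h1 : ‖thetaConst s * thetaNum s u + thetaDen s u‖ ≤
        ‖thetaConst s * thetaNum s u - thetaDen s u‖ := by
      rw [show thetaConst s * thetaNum s u + thetaDen s u =
        thetaConst s * thetaNum s u - -thetaDen s u by ring,
        show thetaConst s * thetaNum s u - thetaDen s u =
        thetaConst s * thetaNum s u + -thetaDen s u by ring, norm_sub_le_norm_add_iff, map_neg,
        mul_neg, mul_assoc, Complex.neg_re, Complex.re_ofReal_mul, h0]
      simp
    have h2 : ‖thetaConst s * thetaNum s u + thetaDen s u‖ = 0 := by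
      nlinarith [norm_nonneg (thetaConst s * thetaNum s u + thetaDen s u)]
    have h3 : ‖thetaConst s * thetaNum s u - thetaDen s u‖ = 0 :=
      le_antisymm (by rw [h2, mul_zero] at hut; exact hut) (norm_nonneg _)
    rw [norm_eq_zero] at h2 h3
    have h4 : thetaDen s u = 0 := by linear_combination (h2 - h3) / 2
    have h5 : (thetaConst s : ℂ) * thetaNum s u = 0 := by linear_combination (h2 + h3) / 2
    have h6 := (mul_eq_zero.mp h5).resolve_left (by exact_mod_cast hc.ne')
    have := normSq_thetaNum_add_pos hs u
    simp [h4, h6] at this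
  · intro v hv hvt
    refine ⟨bernsteinEllipse_subset_closedEllipse _ hv, ?_⟩
    rw [mem_ofPred_eq]
    rw [cayley_thetaQuo hs hv, norm_div] at hvt
    -- A zero denominator, for which the quotient has value `0`, must be excluded before clearing
    -- it.
    rcases (norm_nonneg (thetaConst s * thetaNum s v + thetaDen s v)).eq_or_lt with h | h
    · exfalso
      have h4 : (thetaConst s * thetaNum s v + thetaDen s v : ℂ) = 0 := norm_eq_zero.mp h.symm
      have h5 : thetaQuo s v + 1 = 0 := by
        rw [thetaQuo_eq hs, div_add_one (thetaDen_ne_zero hs hv), h4, zero_div]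
      exact add_one_ne_zero_of_re_nonneg (re_thetaQuo_pos hs hv).le h5
    · exact ((div_lt_iff₀ h).mp hvt).le

/-- A map of the ellipse into the right half-plane with the right values at `±1` is `thetaQuo`. -/
theorem eqOn_thetaQuo {s : ℝ} (hs : 0 < s) {G : ℂ → ℂ}
    (hG : DifferentiableOn ℂ G (bernsteinEllipse (Real.exp (Real.pi * s) : ℝ)))
    (hre : ∀ u ∈ bernsteinEllipse (Real.exp (Real.pi * s) : ℝ), 0 ≤ (G u).re)
    (h1 : G 1 = 1) (hn1 : G (-1) = thetaModulus s) :
    EqOn G (thetaQuo s) (bernsteinEllipse (Real.exp (Real.pi * s) : ℝ)) := by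
  set E := bernsteinEllipse (Real.exp (Real.pi * s) : ℝ)
  have hpos : ∀ u ∈ E, 0 < (thetaQuo s u).re := fun u hu => re_thetaQuo_pos hs hu
  have hBd := differentiableOn_cayley_comp (differentiableOn_thetaQuo hs) fun u hu => (hpos u hu).le
  have hinj : InjOn (fun u => cayley (thetaQuo s u)) E := fun u hu v hv h =>
    injOn_thetaQuo hs hu hv (cayley_injOn (add_one_ne_zero_of_re_nonneg (hpos u hu).le)
      (add_one_ne_zero_of_re_nonneg (hpos v hv).le) h)
  have hEo : IsOpen E := isOpen_bernsteinEllipse _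
  have hB1 : cayley (thetaQuo s 1) = 0 := by simp [thetaQuo_one hs, cayley]
  have key := eqOn_of_norm_le_one_of_proper hEo (isBounded_bernsteinEllipse (pi_mul_pos hs))
    (convex_bernsteinEllipse (one_lt_exp_pi_mul hs)).isPreconnected hBd
    (differentiableOn_cayley_comp hG hre) (fun v hv => norm_cayley_lt_one (hpos v hv))
    (fun t ht => cayley_thetaQuo_proper hs ht) (one_mem_ellipse hs) (neg_one_mem_ellipse hs)
    (by norm_num) hB1 (deriv_ne_zero_of_injOn hEo hBd hinj (one_mem_ellipse hs))
    (fun v hv h => hinj hv (one_mem_ellipse hs) (h.trans hB1.symm))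
    (fun v hv => norm_cayley_le_one (hre v hv)) (by simp [h1, cayley])
    (by simp only [hn1, thetaQuo_neg_one hs])
  exact fun u hu => cayley_injOn (add_one_ne_zero_of_re_nonneg (hre u hu))
    (add_one_ne_zero_of_re_nonneg (hpos u hu).le) (key hu)

/-- `thetaQuo` has no analytic continuation to a larger Bernstein ellipse. -/
theorem not_eqOn_thetaQuo {s : ℝ} (hs : 0 < s) {σ : EReal}
    (hσ : (Real.exp (Real.pi * s) : ℝ) < σ) {G : ℂ → ℂ}
    (hG : AnalyticOnNhd ℂ G (bernsteinEllipse σ)) :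
    ¬ EqOn G (thetaQuo s) (bernsteinEllipse (Real.exp (Real.pi * s) : ℝ)) := by
  intro h
  have h1 := one_lt_exp_pi_mul hs
  have hsub := bernsteinEllipse_mono h1 hσ.le
  have h0 := one_mem_ellipse hs
  -- Cross-multiplied, the identity propagates to the larger ellipse past the zeros of `thetaDen`.
  have heq : EqOn (fun u => G u * thetaDen s u) (fun u => thetaConst s * thetaNum s u)
      (bernsteinEllipse σ) := by
    refine AnalyticOnNhd.eqOn_of_preconnected_of_eventuallyEq
      (hG.mul fun u _ => (differentiable_thetaDen hs).analyticAt u)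
      (fun u _ => analyticAt_const.mul ((differentiable_thetaNum hs).analyticAt u))
      (convex_bernsteinEllipse (h1.trans hσ)).isPreconnected (hsub h0) ?_
    filter_upwards [(isOpen_bernsteinEllipse _).mem_nhds h0] with u hu
    rw [h hu, thetaQuo_eq hs, div_mul_cancel₀ _ (thetaDen_ne_zero hs hu)]
  -- This boundary point of the smaller ellipse is a zero of `thetaDen`; the propagated identity
  -- would make it a zero of `thetaNum` too.
  have hmem : Complex.cos (I * (Real.pi * s : ℝ)) ∈ bernsteinEllipse σ := by
    by_cases ht : σ = ⊤
    · simp [bernsteinEllipse, ht]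
    · have h3 := toReal_gt_one (h1.trans hσ) ht
      have hcoe : ((Real.exp (Real.log σ.toReal) : ℝ) : EReal) = σ := by
        rw [Real.exp_log (by linarith)]
        exact EReal.coe_toReal ht (ne_bot_of_gt hσ)
      rw [← hcoe] at hσ ⊢
      have hlt : Real.pi * s < Real.log σ.toReal := Real.exp_lt_exp.mp (by exact_mod_cast hσ)
      have := pi_mul_pos hs
      rw [cos_mem_bernsteinEllipse (this.trans hlt)]
      simpa [abs_of_pos hs, abs_of_pos Real.pi_pos] using hlt
  have h2 := heq hmem
  have e : I * (Real.pi * s : ℝ) / (2 * Real.pi) + 1 / 2 = 1 / 2 + I * s / 2 := by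
    have := ofReal_two_pi_ne_zero
    push_cast
    field_simp
    ring
  have hD : thetaDen s (Complex.cos (I * (Real.pi * s : ℝ))) = 0 := by
    rw [thetaDen_cos hs, e, theta_half_period]
  have hN : thetaNum s (Complex.cos (I * (Real.pi * s : ℝ))) = 0 := by
    simp only [hD, mul_zero] at h2
    exact (mul_eq_zero.mp h2.symm).resolve_left (by exact_mod_cast (thetaConst_pos hs).ne')
  have := normSq_thetaNum_add_pos hs (Complex.cos (I * (Real.pi * s : ℝ)))
  rw [hD, hN, map_zero, add_zero] at this
  exact lt_irrefl _ this

end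

/-! ### The extremal property -/

theorem rhoA_eq_and_rhoHat_eq {s : ℝ} (hs : 0 < s) {φ : ℝ → ℝ}
    (h : IsContinuation φ (Real.exp (Real.pi * s) : ℝ) (thetaQuo s)) :
    rhoA φ = (Real.exp (Real.pi * s) : ℝ) ∧ rhoHat φ = (Real.exp (Real.pi * s) : ℝ) := by
  have h1 := one_lt_exp_pi_mul hs
  have hA : rhoA φ = (Real.exp (Real.pi * s) : ℝ) := by
    refine le_antisymm (sSup_le ?_) (le_sSup (Or.inr ⟨h1, _, h⟩))
    rintro ρ (rfl | ⟨_, G, hG⟩)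
    · exact h1.le
    · by_contra hlt
      rw [not_le] at hlt
      exact not_eqOn_thetaQuo hs hlt hG.1 (h.eqOn h1 hlt.le hG).symm
  have hc := isContinuation_cont (F := φ) (hA ▸ h1)
  have hnn : 0 ≤ infRe φ (rhoA φ) := by
    rw [hA] at hc ⊢
    refine le_iInf₂ fun u hu => ?_
    rw [hc.eqOn h1 le_rfl h hu]
    exact_mod_cast (re_thetaQuo_pos hs hu).le
  exact ⟨hA, by rw [rhoHat, if_pos hnn, hA]⟩

/-- The value `1` is the default of `rho0`. It lies below `exp (π s)`, so the existence of a
crossing parameter need not be shown. -/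
theorem rhoHat_eq_one_or {φ : ℝ → ℝ} :
    rhoHat φ = 1 ∨ (rhoHat φ ≤ rhoA φ ∧ 0 ≤ infRe φ (rhoHat φ)) := by
  classical
  by_cases h0 : 0 ≤ infRe φ (rhoA φ)
  · right
    rw [rhoHat, if_pos h0]
    exact ⟨le_rfl, h0⟩
  rw [rhoHat, if_neg h0]
  by_cases h : ∃ ρ : ℝ, 1 < ρ ∧ (ρ : EReal) < rhoA φ ∧ infRe φ ρ = 0
  · right
    rw [rho0, dif_pos h]
    exact ⟨h.choose_spec.2.1.le, h.choose_spec.2.2.ge⟩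
  · left
    rw [rho0, dif_neg h, EReal.coe_one]

/-- The core of the extremal property: rigidity on the ellipse with parameter `exp (π s)` gives
uniqueness, and the boundary pole then forbids a larger `σ`. -/
theorem eqOn_cont_of_le {s : ℝ} (hs : 0 < s) {φ : ℝ → ℝ} (hφ : φ ∈ admissible (thetaModulus s))
    {σ : EReal} (hσ : (Real.exp (Real.pi * s) : ℝ) ≤ σ) (hσA : σ ≤ rhoA φ)
    (hinf : 0 ≤ infRe φ σ) :
    σ = (Real.exp (Real.pi * s) : ℝ) ∧
      EqOn (cont φ) (thetaQuo s) (bernsteinEllipse (Real.exp (Real.pi * s) : ℝ)) := by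
  obtain ⟨hφ0, hφ1, _, _, hA⟩ := hφ
  have h1 := one_lt_exp_pi_mul hs
  have hc := isContinuation_cont hA
  have hsub := bernsteinEllipse_mono h1 hσ
  have han : AnalyticOnNhd ℂ (cont φ) (bernsteinEllipse σ) :=
    hc.1.mono (bernsteinEllipse_mono (h1.trans_le hσ) hσA)
  have hre : ∀ u ∈ bernsteinEllipse σ, 0 ≤ (cont φ u).re := fun u hu => by
    exact_mod_cast (le_iInf₂_iff.mp hinf) u hu
  have heq := eqOn_thetaQuo hs (han.differentiableOn.mono hsub) (fun u hu => hre u (hsub hu))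
    (by simpa [hφ1] using hc.2 1 (by norm_num)) (by simpa [hφ0] using hc.2 (-1) (by norm_num))
  exact ⟨(hσ.eq_or_lt.resolve_right fun hlt => not_eqOn_thetaQuo hs hlt han heq).symm, heq⟩

theorem rhoHat_le {s : ℝ} (hs : 0 < s) {φ : ℝ → ℝ} (hφ : φ ∈ admissible (thetaModulus s)) :
    rhoHat φ ≤ (Real.exp (Real.pi * s) : ℝ) := by
  rcases rhoHat_eq_one_or (φ := φ) with h | ⟨hA, hinf⟩
  · exact h ▸ (one_lt_exp_pi_mul hs).le
  · by_contra hlt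
    rw [not_le] at hlt
    exact hlt.ne' (eqOn_cont_of_le hs hφ hlt.le hA hinf).1

theorem rhoHat_eq_iff {s : ℝ} (hs : 0 < s) {φ : ℝ → ℝ} (hφ : φ ∈ admissible (thetaModulus s)) :
    rhoHat φ = (Real.exp (Real.pi * s) : ℝ) ↔
      EqOn (cont φ) (thetaQuo s) (bernsteinEllipse (Real.exp (Real.pi * s) : ℝ)) := by
  have h1 := one_lt_exp_pi_mul hs
  constructor
  · intro h
    rcases rhoHat_eq_one_or (φ := φ) with h' | ⟨hA, hinf⟩
    · exact absurd (h'.symm.trans h) h1.ne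
    · exact (eqOn_cont_of_le hs hφ h.ge hA hinf).2
  · intro h
    refine (rhoA_eq_and_rhoHat_eq hs ⟨(differentiableOn_thetaQuo hs).analyticOnNhd
      (isOpen_bernsteinEllipse _), fun x hx => ?_⟩).2
    rw [← h (Icc_mem_bernsteinEllipse h1 hx)]
    exact (isContinuation_cont hφ.2.2.2.2).2 x hx

/-! ### Identification of `Φ_r` with the theta quotient and the main theorem -/

theorem ellipticK_ratio_pos {r : ℝ} (hr0 : 0 < r) (hr1 : r < 1) :
    0 < ellipticK r / ellipticK √(1 - r ^ 2) := by
  have hr2 : r ^ 2 < 1 := by nlinarith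
  exact div_pos (ellipticK_pos hr2) (ellipticK_pos (by
    rw [Real.sq_sqrt (by linarith)]; nlinarith))

/-- The modulus complementary to `√(1 - r²)` is `r`, so the lattice parameter is `i s`, and `K(k)`
cancels from the argument of `dn`. -/
theorem Phi_eq_thetaQuo {r : ℝ} (hr0 : 0 < r) (hr1 : r < 1) :
    Phi r = thetaQuo (ellipticK r / ellipticK √(1 - r ^ 2)) := by
  have hr2 : r ^ 2 < 1 := by nlinarith
  have hK : (ellipticK √(1 - r ^ 2) : ℂ) ≠ 0 := by
    exact_mod_cast (ellipticK_pos (by rw [Real.sq_sqrt (by linarith)]; nlinarith)).ne'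
  have hτ : latticeTau √(1 - r ^ 2) =
      Complex.I * ((ellipticK r / ellipticK √(1 - r ^ 2) : ℝ) : ℂ) := by
    rw [latticeTau, Real.sq_sqrt (by linarith), sub_sub_cancel, Real.sqrt_sq hr0.le]
  ext u
  have hv : ellipticK √(1 - r ^ 2) * arccosC u / Real.pi / (2 * ellipticK √(1 - r ^ 2)) =
      arccosC u / (2 * Real.pi) := by
    have := ofReal_two_pi_ne_zero
    field_simp
  rw [Phi, jacobiDn, hτ, hv]
  rfl

theorem PhiReal_mem_admissible {r : ℝ} (hr0 : 0 < r) (hr1 : r < 1) :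
    (∀ x ∈ Icc (-1 : ℝ) 1, (PhiReal r x : ℂ) = Phi r (x : ℂ)) ∧ PhiReal r ∈ admissible r := by
  have hs := ellipticK_ratio_pos hr0 hr1
  have hm := thetaModulus_ratio hr0 hr1
  set s := ellipticK r / ellipticK √(1 - r ^ 2)
  have hΦ : Phi r = thetaQuo s := Phi_eq_thetaQuo hr0 hr1
  have h1 := one_lt_exp_pi_mul hs
  have hreal : ∀ x ∈ Icc (-1 : ℝ) 1, (PhiReal r x : ℂ) = Phi r (x : ℂ) := fun x hx => by
    rw [PhiReal, hΦ, Complex.ext_iff]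
    exact ⟨rfl, (thetaQuo_ofReal_im hs hx).symm⟩
  have hcont : IsContinuation (PhiReal r) (Real.exp (Real.pi * s) : ℝ) (thetaQuo s) :=
    ⟨(differentiableOn_thetaQuo hs).analyticOnNhd (isOpen_bernsteinEllipse _),
      fun x hx => by rw [hreal x hx, hΦ]⟩
  have e0 : PhiReal r (-1) = r := by
    rw [PhiReal, hΦ]
    simp [thetaQuo_neg_one hs, hm]
  have e1 : PhiReal r 1 = 1 := by
    rw [PhiReal, hΦ]
    simp [thetaQuo_one hs]
  have hco : ContinuousOn (PhiReal r) (Icc (-1) 1) := by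
    have h := (differentiableOn_thetaQuo hs).continuousOn.comp
      Complex.continuous_ofReal.continuousOn fun x hx => Icc_mem_bernsteinEllipse h1 hx
    refine (Complex.continuous_re.comp_continuousOn h).congr fun x _ => ?_
    rw [PhiReal, hΦ]
    rfl
  have hinj : InjOn (PhiReal r) (Icc (-1) 1) := fun x hx y hy h => by
    have h' : thetaQuo s x = thetaQuo s y := by
      rw [← hΦ, ← hreal x hx, ← hreal y hy, h]
    exact_mod_cast injOn_thetaQuo hs (Icc_mem_bernsteinEllipse h1 hx)
      (Icc_mem_bernsteinEllipse h1 hy) h'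
  refine ⟨hreal, e0, e1, hco, ?_, ?_⟩
  -- Monotonicity needs no derivative: a continuous injective function on an interval is strictly
  -- monotone, and the endpoint values fix the direction.
  · exact hco.strictMonoOn_of_injOn_Icc (by norm_num) (by rw [e0, e1]; exact hr1.le) hinj
  · rw [(rhoA_eq_and_rhoHat_eq hs hcont).1]
    exact h1

end ExpSum

end

theorem mainTheorem2 (r : ℝ) (hr0 : 0 < r) (hr1 : r < 1) :
    (∀ x ∈ Set.Icc (-1 : ℝ) 1, (ExpSum.PhiReal r x : ℂ) = ExpSum.Phi r (x : ℂ)) ∧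
    ExpSum.PhiReal r ∈ ExpSum.admissible r ∧
    IsGreatest (ExpSum.rhoHat '' ExpSum.admissible r) (ExpSum.rhoHat (ExpSum.PhiReal r)) ∧
    (∀ φ ∈ ExpSum.admissible r,
      (IsGreatest (ExpSum.rhoHat '' ExpSum.admissible r) (ExpSum.rhoHat φ) ↔
        Set.EqOn (ExpSum.cont φ) (ExpSum.Phi r)
          (ExpSum.bernsteinEllipse
            (Real.exp (Real.pi * ExpSum.ellipticK r / ExpSum.ellipticK √(1 - r ^ 2)) : ℝ)))) ∧
    ExpSum.rhoHat (ExpSum.PhiReal r) = ExpSum.rhoA (ExpSum.PhiReal r) ∧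
    ExpSum.rhoHat (ExpSum.PhiReal r) =
      (Real.exp (Real.pi * ExpSum.ellipticK r / ExpSum.ellipticK √(1 - r ^ 2)) : ℝ) := by
  obtain ⟨hreal, hadm⟩ := ExpSum.PhiReal_mem_admissible hr0 hr1
  have hs := ExpSum.ellipticK_ratio_pos hr0 hr1
  have hm := ExpSum.thetaModulus_ratio hr0 hr1
  have hΦ := ExpSum.Phi_eq_thetaQuo hr0 hr1
  rw [mul_div_assoc, hΦ]
  set s := ExpSum.ellipticK r / ExpSum.ellipticK √(1 - r ^ 2)
  obtain ⟨hA, hhat⟩ := ExpSum.rhoA_eq_and_rhoHat_eq hs (φ := ExpSum.PhiReal r)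
    ⟨(ExpSum.differentiableOn_thetaQuo hs).analyticOnNhd (ExpSum.isOpen_bernsteinEllipse _),
      fun x hx => by rw [hreal x hx, hΦ]⟩
  have hgreat : IsGreatest (ExpSum.rhoHat '' ExpSum.admissible r)
      (ExpSum.rhoHat (ExpSum.PhiReal r)) := by
    refine ⟨Set.mem_image_of_mem _ hadm, ?_⟩
    rintro _ ⟨φ, hφ, rfl⟩
    rw [hhat]
    exact ExpSum.rhoHat_le hs (by rwa [hm])
  refine ⟨fun x hx => (hreal x hx).trans (congrFun hΦ _), hadm, hgreat, fun φ hφ => ?_,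
    hhat.trans hA.symm, hhat⟩
  rw [← ExpSum.rhoHat_eq_iff hs (by rwa [hm]), ← hhat]
  exact ⟨fun h => h.unique hgreat, fun h => h ▸ hgreat⟩
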